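/- **Setting.** For $n\ge 1$ and $p\in(0,1)$ put $$k:=\Bigl\lceil \tfrac19\log_{1/p}n\Bigr\rceil,\quad I:=\lceil 9k^{9}\log k\rceil,\quad p_i:=p\,e^{-i/k^{9}},\quad k_i:=\Bigl\lceil \tfrac19\log_{1/p_i}n\Bigr\rceil,\quad \varepsilon:=n^{-1/9},$$ $$\mu_{s,j,i}:=\binom{n-s}{j-s}p_i^{\binom j2-\binom s2},\qquad \lambda_{s,i}:=(n-s)p_i^{s},\qquad q_i:=\frac1{(1+\varepsilon)k^{9}\mu_{2,k_i,i}}.$$ For a graph $G_i=([n],E_i)$ and $S\subseteq[n]$ let $$\mathcal C_{S,j,i}:=\Bigl\{J\subseteq[n]: S\subseteq J,\ |J|=j,\ \tbinom J2\setminus\tbinom S2\subseteq E_i\Bigr\},\qquad N_{S,i}:=\bigl|\{w\in[n]\setminus S:\ \{v,w\}\in E_i\text{ for all }v\in S\}\bigr|,$$ and for $e\in E_i$ let $\zeta_{e,i}:=1-(1-q_i)^{\max\{(1+\varepsilon)\mu_{2,k_i,i}-|\mathcal C_{e,k_i,i}|,\,0\}}$. For a family $F$ of cliques let $E(F)$ be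 the set of edges they cover. **Nibble algorithm.** Start with the binomial random graph $G_0=([n],E_0)=G_{n,p}$ and $\mathcal P_0=\emptyset$. For $i=0,1,\dots,I-1$: let $\Gamma_i\subseteq\mathcal C_{\emptyset,k_i,i}$ contain each $k_i$-vertex clique of $G_i$ independently with probability $q_i$; independently, let $S_i\subseteq E_i$ contain each edge $e\in E_i$ independently with probability $\zeta_{e,i}$; let $\Gamma_i^*$ be a size-maximal collection of edge-disjoint cliques in $\Gamma_i$ (chosen by an arbitrary rule); put $\mathcal P_{i+1}:=\mathcal P_i\cup\Gamma_i^*\cup(E(\Gamma_i)\setminus E(\Gamma_i^*))\cup(S_i\setminus E(\Gamma_i))$ and $G_{i+1}:=([n],E_{i+1})$ with $E_{i+1}:=E_i\setminus(E(\Gamma_i)\cup S_i)$. (For all large $n$ the numbers $q_i,\zeta_{e,i}$ lie in $[0,1]$ in the range of $p$ below; for small $n$ clamp them to $[0,1]$.) **Events.** Write $a=(1\pm\delta)b$ for $(1-\delta)b\le a\le(1+\delta)b$. Let $\mathcal N_i$ be the event that for all $S\subseteq[n]$ with $0\le|S|\le k_i-1$, $$N_{S,i}=\bigl(1\pm(i+1)\varepsilon^2\bigr)\lambda_{|S|,i},$$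 and let $\mathcal R_i$ be the event that for all $S\subseteq[n]$ and $j$ with $0\le|S|\le j\le k_i$, $$|\mathcal C_{S,j,i}|=(1\pm\varepsilon)\,\mu_{|S|,j,i}.$$ **Theorem.** Let $\gamma\in(0,1)$ be a constant. 1. If $p=p(n)$ satisfies $n^{-1/81}\le p\le 1-\gamma$, then with probability at least $1-n^{-\omega(1)}$ the events $\mathcal N_i$ hold for all $0\le i\le I$, and likewise with probability at least $1-n^{-\omega(1)}$ the events $\mathcal R_i$ hold for all $0\le i\le I$. That is, for every $A>0$ there is $n_0=n_0(\gamma,A)$ such that for all $n\ge n_0$ and all $p\in[n^{-1/81},1-\gamma]$ each of these two probabilities is at least $1-n^{-A}$. 2. There is $n_0=n_0(\gamma)$ such that for all $n\ge n_0$, all $p\in[n^{-1/81},1-\gamma]$ and all $0\le i\le I$, the event $\mathcal N_i$ implies the event $\mathcal R_i$ (indeed, the estimates of $\mathcal N_i$ imply those of $\mathcal R_i$ for every graph $G_i$ on $[n]$). -/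

import Mathlib

namespace Nibble

open scoped Classical

noncomputable section

/-! ### The numerical parameters (with the fixed constants `1/9` and `9`) -/

/-- `k(x) = ⌈(1/9) log_{1/x} n⌉`. The parameters `k` and `k_i` of the algorithm are `k(p)` and
`k(p_i)`. -/
def cliqueSize (n : ℕ) (x : ℝ) : ℕ := ⌈(1 / 9 : ℝ) * Real.logb (1 / x) n⌉₊

/-- The number of iterations `I = ⌈9 k^9 log k⌉`. -/
def numSteps (n : ℕ) (p : ℝ) : ℕ :=
  ⌈9 * (cliqueSize n p : ℝ) ^ 9 * Real.log (cliqueSize n p)⌉₊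

/-- The edge-probabilities `p_i = p e^{-i/k^9}`. -/
def pAt (n : ℕ) (p : ℝ) (i : ℕ) : ℝ := p * Real.exp (-(i : ℝ) / (cliqueSize n p : ℝ) ^ 9)

/-- The clique sizes `k_i = ⌈(1/9) log_{1/p_i} n⌉`. -/
def kAt (n : ℕ) (p : ℝ) (i : ℕ) : ℕ := cliqueSize n (pAt n p i)

/-- The error parameter `ε = n^{-1/9}`. -/
def eps (n : ℕ) : ℝ := (n : ℝ) ^ (-(1 / 9) : ℝ)

/-- `μ_{s,j,i} = C(n-s, j-s) p_i^{C(j,2) - C(s,2)}` (used for `s ≤ j` only). -/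
def muAt (n : ℕ) (p : ℝ) (s j i : ℕ) : ℝ :=
  ((n - s).choose (j - s) : ℝ) * pAt n p i ^ (j.choose 2 - s.choose 2)

/-- `λ_{s,i} = (n - s) p_i^s`. -/
def lambdaAt (n : ℕ) (p : ℝ) (s i : ℕ) : ℝ := ((n : ℝ) - s) * pAt n p i ^ s

/-- `q_i = 1 / ((1 + ε) k^9 μ_{2,k_i,i})`. -/
def qAt (n : ℕ) (p : ℝ) (i : ℕ) : ℝ :=
  1 / ((1 + eps n) * (cliqueSize n p : ℝ) ^ 9 * muAt n p 2 (kAt n p i) i)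

/-! ### Clique and common-neighbour statistics of a graph on `[n]` -/

/-- `C_{S,j}(G)`: the `j`-element vertex sets `J ⊇ S` such that all pairs in `J`, except possibly
those inside `S`, are edges of `G`. -/
def cliqueExt {n : ℕ} (G : SimpleGraph (Fin n)) (S : Finset (Fin n)) (j : ℕ) :
    Finset (Finset (Fin n)) :=
  Finset.univ.filter fun J => S ⊆ J ∧ J.card = j ∧
    ∀ x ∈ J, ∀ y ∈ J, x ≠ y → ¬ (x ∈ S ∧ y ∈ S) → G.Adj x y

/-- `N_S(G)`: the number of vertices outside `S` that are adjacent to all vertices of `S`. -/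
def commonNbrs {n : ℕ} (G : SimpleGraph (Fin n)) (S : Finset (Fin n)) : ℕ :=
  (Finset.univ.filter fun w => w ∉ S ∧ ∀ v ∈ S, G.Adj v w).card

/-- `E(F)`: the edges covered by a family `F` of vertex sets of cliques. -/
def coveredEdges {n : ℕ} (F : Finset (Finset (Fin n))) : Finset (Sym2 (Fin n)) :=
  Finset.univ.filter fun e => ¬ e.IsDiag ∧ ∃ K ∈ F, ∀ v ∈ e, v ∈ K

/-- The stabilization probability
`ζ_{e,i} = 1 - (1 - q_i)^{max{(1 + ε) μ_{2,k_i,i} - |C_{e,k_i,i}|, 0}}`. -/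
def zetaAt {n : ℕ} (p : ℝ) (i : ℕ) (G : SimpleGraph (Fin n)) (e : Sym2 (Fin n)) : ℝ :=
  1 - (1 - qAt n p i) ^ max ((1 + eps n) * muAt n p 2 (kAt n p i) i
    - ((cliqueExt G e.toFinset (kAt n p i)).card : ℝ)) 0

/-! ### The algorithm -/

/-- A real number clamped to `[0,1]`. (The numbers `q_i` and `ζ_{e,i}` used as probabilities lie in
`[0,1]` for all large `n`; then clamping changes nothing.) -/
def clamp (x : ℝ) : NNReal := min x.toNNReal 1

/-- The random subset of the finite set `s` in which each `a ∈ s` is included independently with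
probability `r a`. -/
def randomSubset {α : Type} [Fintype α] (s : Finset α) (r : α → ℝ) : PMF (Finset α) :=
  PMF.ofFinset
    (fun T => if T ⊆ s then
      (((∏ a ∈ T, clamp (r a)) * ∏ a ∈ s \ T, (1 - clamp (r a)) : NNReal) : ENNReal) else 0)
    s.powerset
    (by
      have h : ∀ a, clamp (r a) + (1 - clamp (r a)) = 1 := fun a =>
        add_tsub_cancel_of_le (min_le_right _ _)
      rw [Finset.sum_congr rfl fun T hT => if_pos (Finset.mem_powerset.1 hT)]
      rw [← ENNReal.ofNNReal_finsetSum, ← Finset.prod_add, Finset.prod_congr rfl fun a _ => h a]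
      simp)
    (by
      intro T hT
      rw [if_neg (by simpa using hT)])

/-- The members of `F` are pairwise edge-disjoint. -/
def EdgeDisjoint {n : ℕ} (F : Finset (Finset (Fin n))) : Prop :=
  ∀ K ∈ F, ∀ K' ∈ F, K ≠ K' → Disjoint (coveredEdges {K}) (coveredEdges {K'})

/-- `M` is a size-maximal collection of pairwise edge-disjoint members of `Γ`. -/
def IsMaxPacking {n : ℕ} (Γ M : Finset (Finset (Fin n))) : Prop :=
  M ⊆ Γ ∧ EdgeDisjoint M ∧ ∀ F ⊆ Γ, EdgeDisjoint F → F.card ≤ M.card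

/-- The state after `i` iterations: the graph `G_i` and the collection `P_i` of (vertex sets of)
cliques chosen so far. -/
structure State (n : ℕ) where
  graph : SimpleGraph (Fin n)
  partition : Finset (Finset (Fin n))

/-- The deterministic part of an iteration, given the sampled cliques `Γ`, the sampled edges `S`
and the size-maximal edge-disjoint collection `M = Γ*`. -/
def nextState {n : ℕ} (s : State n) (Γ : Finset (Finset (Fin n))) (S : Finset (Sym2 (Fin n)))
    (M : Finset (Finset (Fin n))) : State n where
  graph := s.graph.deleteEdges ↑(coveredEdges Γ ∪ S)
  partition := s.partition ∪ M ∪ (coveredEdges Γ \ coveredEdges M).image Sym2.toFinset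
    ∪ (S \ coveredEdges Γ).image Sym2.toFinset

/-- Iteration `i` of the algorithm; the rule `sel` picks the collection `Γ*` from `Γ`. -/
def step {n : ℕ} (p : ℝ) (sel : Finset (Finset (Fin n)) → Finset (Finset (Fin n))) (i : ℕ)
    (s : State n) : PMF (State n) :=
  (randomSubset (cliqueExt s.graph ∅ (kAt n p i)) fun _ => qAt n p i).bind fun Γ =>
    (randomSubset s.graph.edgeFinset (zetaAt p i s.graph)).map fun S =>
      nextState s Γ S (sel Γ)

instance measurableSingletonClass_simpleGraph (n : ℕ) :
    MeasurableSingletonClass (SimpleGraph (Fin n)) :=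
  ⟨fun G => by
    have h := SimpleGraph.measurableEmbedding_edgeSet.measurable
      (MeasurableSet.singleton (SimpleGraph.edgeSet G))
    convert h using 1
    ext H
    simp⟩

/-- The joint law of the states after `0, 1, …, m` iterations, started from `G_{n,p}`. A trajectory
is recorded as a sequence of states that is constant from time `m` on. -/
def run {n : ℕ} (p : unitInterval) (sel : Finset (Finset (Fin n)) → Finset (Finset (Fin n))) :
    ℕ → PMF (ℕ → State n)
  | 0 => (SimpleGraph.binomialRandom (Fin n) p).toPMF.map fun G _ => ⟨G, ∅⟩
  | m + 1 => (run p sel m).bind fun h =>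
      (step (p : ℝ) sel m (h m)).map fun s j => if j ≤ m then h j else s

/-! ### The pseudo-random properties -/

/-- The property `𝒩_i` of the graph `G = G_i`:
`N_{S,i} = (1 ± (i+1) ε²) λ_{|S|,i}` for all `S` with `|S| ≤ k_i - 1`. -/
def NbrEvent {n : ℕ} (p : ℝ) (i : ℕ) (G : SimpleGraph (Fin n)) : Prop :=
  ∀ S : Finset (Fin n), S.card + 1 ≤ kAt n p i →
    |(commonNbrs G S : ℝ) - lambdaAt n p S.card i| ≤
      ((i : ℝ) + 1) * eps n ^ 2 * lambdaAt n p S.card i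

/-- The property `ℛ_i` of the graph `G = G_i`:
`|C_{S,j,i}| = (1 ± ε) μ_{|S|,j,i}` for all `S` and `j` with `|S| ≤ j ≤ k_i`. -/
def CliqueEvent {n : ℕ} (p : ℝ) (i : ℕ) (G : SimpleGraph (Fin n)) : Prop :=
  ∀ (S : Finset (Fin n)) (j : ℕ), S.card ≤ j → j ≤ kAt n p i →
    |((cliqueExt G S j).card : ℝ) - muAt n p S.card j i| ≤ eps n * muAt n p S.card j i

end

end Nibble

namespace Nibble

open scoped Classical

noncomputable section

/-! ### Random subsets with independent inclusions -/

/-! Write y = n^{1/9} = 1/ε, s = |S| and M = (1+ε)μ_{2,k_i,i}. Since p ≤ 1-γ, both k and I are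
polylogarithmic in n, hence negligible against y.

Neighbour counts control clique counts deterministically. Counting pairs (J, w) with w ∈ J \ S gives
(j-s)|C_{S,j}| = ∑_w |C_{S∪{w},j}| over the common neighbours w of S (`sub_mul_card_cliqueExt`), and
μ obeys the same recursion with λ as the number of terms (`sub_mul_muAt`). So an error factor 1±δ in
each N_S becomes (1±δ)^{j-s} in |C_{S,j}|. With δ = (i+1)ε² and k(I+1)ε² much smaller than ε, this
yields ℛ_i from 𝒩_i (`Regime.cliqueEvent`).

The neighbour estimates propagate. A common neighbour w of S survives iteration i iff no sampled
clique contains w and a vertex of S, and no edge from w to S lies in S_i. The probabilities ζ are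
tuned so that every edge survives with probability (1-q_i)^M, where q_i M = 1/k^9. For the s edges
from w to S, only cliques through two of them break the product formula, and they number at most
s²·2μ_3, which is tiny compared with μ_2. Hence w survives with probability e^{-s/k^9}(1 ± 4/y^8)
(`Regime.survival_prob`), and e^{-s/k^9} is exactly λ_{s,i+1}/λ_{s,i}. The mean thus gains a
relative error of at most ε²/2.

The other ε²/2 absorbs the fluctuations. One clique or edge affects at most k of the w's, so an
exponential-moment bound (`survivors_tail_le`) gives failure probability 2e^{-y} for each S
(`Regime.commonNbrs_tail_le`). A union bound over at most k n^k sets S and I+1 times costs n^{O(log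
n)}, which e^{-y} beats. -/

/-- The expectation of `f T` when `T ⊆ s` contains each `a ∈ s` independently with probability
`r a`. -/
def expect {α : Type} (s : Finset α) (r : α → ℝ) (f : Finset α → ℝ) : ℝ :=
  ∑ T ∈ s.powerset, ((∏ a ∈ T, r a) * ∏ a ∈ s \ T, (1 - r a)) * f T

section Expect

variable {α β ι : Type}

lemma expect_empty (r : α → ℝ) (f : Finset α → ℝ) : expect ∅ r f = f ∅ := by
  simp [expect]

lemma expect_add (s : Finset α) (r : α → ℝ) (f g : Finset α → ℝ) :
    expect s r (fun T => f T + g T) = expect s r f + expect s r g := by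
  simp [expect, mul_add, Finset.sum_add_distrib]

lemma expect_const_mul (s : Finset α) (r : α → ℝ) (c : ℝ) (f : Finset α → ℝ) :
    expect s r (fun T => c * f T) = c * expect s r f := by
  simp only [expect, Finset.mul_sum]
  exact Finset.sum_congr rfl fun T _ => by ring

lemma expect_sum (s : Finset α) (r : α → ℝ) (W : Finset ι) (f : ι → Finset α → ℝ) :
    expect s r (fun T => ∑ w ∈ W, f w T) = ∑ w ∈ W, expect s r (f w) := by
  simp only [expect, Finset.mul_sum]
  exact Finset.sum_comm

lemma expect_congr {s : Finset α} {r : α → ℝ} {f g : Finset α → ℝ} (h : ∀ T ⊆ s, f T = g T) :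
    expect s r f = expect s r g :=
  Finset.sum_congr rfl fun T hT => by rw [h T (Finset.mem_powerset.1 hT)]

lemma weight_nonneg {s : Finset α} {r : α → ℝ} (h0 : ∀ a, 0 ≤ r a) (h1 : ∀ a, r a ≤ 1)
    (T : Finset α) : 0 ≤ (∏ a ∈ T, r a) * ∏ a ∈ s \ T, (1 - r a) :=
  mul_nonneg (Finset.prod_nonneg fun a _ => h0 a)
    (Finset.prod_nonneg fun a _ => sub_nonneg.2 (h1 a))

lemma expect_mono {s : Finset α} {r : α → ℝ} (h0 : ∀ a, 0 ≤ r a) (h1 : ∀ a, r a ≤ 1)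
    {f g : Finset α → ℝ} (h : ∀ T ⊆ s, f T ≤ g T) : expect s r f ≤ expect s r g :=
  Finset.sum_le_sum fun T hT =>
    mul_le_mul_of_nonneg_left (h T (Finset.mem_powerset.1 hT)) (weight_nonneg h0 h1 T)

lemma expect_nonneg {s : Finset α} {r : α → ℝ} (h0 : ∀ a, 0 ≤ r a) (h1 : ∀ a, r a ≤ 1)
    {f : Finset α → ℝ} (h : ∀ T ⊆ s, 0 ≤ f T) : 0 ≤ expect s r f :=
  Finset.sum_nonneg fun T hT =>
    mul_nonneg (weight_nonneg h0 h1 T) (h T (Finset.mem_powerset.1 hT))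

/-- Conditioning on whether `a` is included; this drives the induction for exponential moments. -/
lemma expect_insert {a : α} {s : Finset α} (ha : a ∉ s) (r : α → ℝ) (f : Finset α → ℝ) :
    expect (insert a s) r f =
      expect s r (fun T => (1 - r a) * f T + r a * f (insert a T)) := by
  unfold expect
  rw [Finset.sum_powerset_insert ha, ← Finset.sum_add_distrib]
  refine Finset.sum_congr rfl fun T hT => ?_
  have hT' : T ⊆ s := Finset.mem_powerset.1 hT
  have haT : a ∉ T := fun h => ha (hT' h)
  have e1 : insert a s \ T = insert a (s \ T) := Finset.insert_sdiff_of_notMem _ haT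
  have e2 : insert a s \ insert a T = s \ T := by
    rw [Finset.insert_sdiff_insert]
    exact Finset.sdiff_insert_of_notMem ha T
  rw [e1, e2, Finset.prod_insert haT, Finset.prod_insert (by simp [ha])]
  ring

/-- The expectation of a product of functions of the individual inclusions factorises. -/
lemma expect_prod (s : Finset α) (r x y : α → ℝ) :
    expect s r (fun T => (∏ a ∈ T, x a) * ∏ a ∈ s \ T, y a) =
      ∏ a ∈ s, (r a * x a + (1 - r a) * y a) := by
  rw [Finset.prod_add, expect]
  refine Finset.sum_congr rfl fun T _ => ?_
  rw [Finset.prod_mul_distrib, Finset.prod_mul_distrib]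
  ring

lemma expect_disjoint {s B : Finset α} (hB : B ⊆ s) (r : α → ℝ) :
    expect s r (fun T => if Disjoint T B then 1 else 0) = ∏ a ∈ B, (1 - r a) := by
  have h := expect_prod s r (fun a => if a ∈ B then 0 else 1) (fun _ => 1)
  have h2 : ∏ a ∈ s, (r a * (if a ∈ B then 0 else 1) + (1 - r a) * 1) = ∏ a ∈ B, (1 - r a) := by
    rw [← Finset.prod_subset hB]
    · exact Finset.prod_congr rfl fun a ha => by simp [ha]
    · intro a _ ha
      simp [ha]
  rw [← h2, ← h]
  refine expect_congr fun T _ => ?_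
  split_ifs with hd
  · rw [Finset.prod_const_one, mul_one, Finset.prod_eq_one]
    intro a ha
    simp [Finset.disjoint_left.1 hd ha]
  · obtain ⟨a, haT, haB⟩ := Finset.not_disjoint_iff.1 hd
    rw [Finset.prod_eq_zero haT (by simp [haB]), zero_mul]

lemma expect_const (s : Finset α) (r : α → ℝ) (c : ℝ) : expect s r (fun _ => c) = c := by
  have h := expect_prod s r (fun _ => 1) (fun _ => 1)
  simp only [Finset.prod_const_one, mul_one] at h
  have := expect_const_mul s r c (fun _ => 1)
  simp only [mul_one] at this
  rw [this, h]
  simp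

/-- With u = y - x, use e^u ≤ 1 + u + u² for |u| ≤ 1 and then 1 + z ≤ e^z. The error is r d² and not
merely d², so rarely included elements contribute little variance. -/
lemma two_point_exp_le {r x y d : ℝ} (h0 : 0 ≤ r) (hd : |y - x| ≤ d) (hd1 : d ≤ 1) :
    (1 - r) * Real.exp x + r * Real.exp y ≤ Real.exp ((1 - r) * x + r * y + r * d ^ 2) := by
  obtain ⟨u, rfl⟩ : ∃ u, y = x + u := ⟨y - x, by ring⟩
  rw [add_sub_cancel_left] at hd
  have hu := Real.abs_exp_sub_one_sub_id_le (hd.trans hd1)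
  have hu2 : Real.exp u ≤ 1 + u + d ^ 2 := by
    have : u ^ 2 ≤ d ^ 2 := sq_le_sq' (by linarith [neg_abs_le u]) (by linarith [le_abs_self u])
    linarith [le_abs_self (Real.exp u - 1 - u)]
  have e1 : (1 - r) * x + r * (x + u) + r * d ^ 2 = x + r * (u + d ^ 2) := by ring
  rw [e1, Real.exp_add, Real.exp_add]
  have h3 : (1 - r) + r * Real.exp u ≤ Real.exp (r * (u + d ^ 2)) := by
    have := Real.add_one_le_exp (r * (u + d ^ 2))
    have := mul_le_mul_of_nonneg_left hu2 h0
    linarith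
  have := mul_le_mul_of_nonneg_left h3 (Real.exp_pos x).le
  linarith

/-- An exponential-moment bound for functions with bounded increments. -/
lemma expect_exp_le {r : α → ℝ} (h0 : ∀ a, 0 ≤ r a) (h1 : ∀ a, r a ≤ 1) (c : α → ℝ)
    (s : Finset α) (hc1 : ∀ a ∈ s, c a ≤ 1) (f : Finset α → ℝ)
    (hf : ∀ a ∈ s, ∀ T, |f (insert a T) - f T| ≤ c a) :
    expect s r (fun T => Real.exp (f T)) ≤
      Real.exp (expect s r f + ∑ a ∈ s, r a * c a ^ 2) := by
  induction s using Finset.induction_on generalizing f with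
  | empty => simp [expect_empty]
  | insert a s ha ih =>
    rw [expect_insert ha, expect_insert ha, Finset.sum_insert ha]
    have hstep : expect s r (fun T => (1 - r a) * Real.exp (f T) + r a * Real.exp (f (insert a T)))
        ≤ expect s r (fun T => Real.exp (r a * c a ^ 2) *
          Real.exp ((1 - r a) * f T + r a * f (insert a T))) := by
      refine expect_mono h0 h1 fun T _ => ?_
      rw [← Real.exp_add, add_comm (r a * c a ^ 2)]
      exact two_point_exp_le (h0 a) (hf a (Finset.mem_insert_self _ _) T)
        (hc1 a (Finset.mem_insert_self _ _))
    refine hstep.trans ?_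
    rw [expect_const_mul]
    -- Averaging over the inclusion of `a` is a convex combination, so the increment bounds `c b`
    -- persist.
    have := ih (fun b hb => hc1 b (Finset.mem_insert_of_mem hb))
      (fun T => (1 - r a) * f T + r a * f (insert a T)) (by
        intro b hb T
        have e1 := hf b (Finset.mem_insert_of_mem hb) T
        have e2 := hf b (Finset.mem_insert_of_mem hb) (insert a T)
        rw [Finset.insert_comm] at e2
        have e3 : (1 - r a) * f (insert b T) + r a * f (insert a (insert b T))
            - ((1 - r a) * f T + r a * f (insert a T)) =
            (1 - r a) * (f (insert b T) - f T)
              + r a * (f (insert a (insert b T)) - f (insert a T)) := by ring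
        rw [e3]
        have h1a : 0 ≤ 1 - r a := sub_nonneg.2 (h1 a)
        calc _ ≤ |(1 - r a) * (f (insert b T) - f T)|
              + |r a * (f (insert a (insert b T)) - f (insert a T))| := abs_add_le _ _
          _ = (1 - r a) * |f (insert b T) - f T|
              + r a * |f (insert a (insert b T)) - f (insert a T)| := by
            rw [abs_mul, abs_mul, abs_of_nonneg h1a, abs_of_nonneg (h0 a)]
          _ ≤ (1 - r a) * c b + r a * c b :=
            add_le_add (mul_le_mul_of_nonneg_left e1 h1a) (mul_le_mul_of_nonneg_left e2 (h0 a))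
          _ = c b := by ring)
    calc _ ≤ Real.exp (r a * c a ^ 2) * Real.exp
          (expect s r (fun T => (1 - r a) * f T + r a * f (insert a T))
            + ∑ b ∈ s, r b * c b ^ 2) := mul_le_mul_of_nonneg_left this (Real.exp_pos _).le
      _ = _ := by rw [← Real.exp_add]; congr 1; ring

/-- The exponential-moment bound for a function of two independent random subsets. -/
lemma expect_expect_exp_le {r : α → ℝ} (h0 : ∀ a, 0 ≤ r a) (h1 : ∀ a, r a ≤ 1)
    {r' : β → ℝ} (h0' : ∀ b, 0 ≤ r' b) (h1' : ∀ b, r' b ≤ 1) (c : α → ℝ) (c' : β → ℝ)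
    (s : Finset α) (s' : Finset β) (hc1 : ∀ a ∈ s, c a ≤ 1) (hc1' : ∀ b ∈ s', c' b ≤ 1)
    (f : Finset α → Finset β → ℝ)
    (hf : ∀ a ∈ s, ∀ T T', |f (insert a T) T' - f T T'| ≤ c a)
    (hf' : ∀ b ∈ s', ∀ T T', |f T (insert b T') - f T T'| ≤ c' b) :
    expect s r (fun T => expect s' r' fun T' => Real.exp (f T T')) ≤
      Real.exp (expect s r (fun T => expect s' r' (f T))
        + (∑ a ∈ s, r a * c a ^ 2 + ∑ b ∈ s', r' b * c' b ^ 2)) := by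
  calc _ ≤ expect s r (fun T => Real.exp (∑ b ∈ s', r' b * c' b ^ 2) *
        Real.exp (expect s' r' (f T))) := by
        refine expect_mono h0 h1 fun T _ => ?_
        rw [← Real.exp_add, add_comm]
        exact expect_exp_le h0' h1' c' s' hc1' (f T) fun b hb T' => hf' b hb T T'
    _ ≤ Real.exp (∑ b ∈ s', r' b * c' b ^ 2) *
        Real.exp (expect s r (fun T => expect s' r' (f T)) + ∑ a ∈ s, r a * c a ^ 2) := by
        rw [expect_const_mul]
        refine mul_le_mul_of_nonneg_left (expect_exp_le h0 h1 c s hc1 _ fun a ha T => ?_)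
          (Real.exp_pos _).le
        -- Integrating out the second random set preserves the increment bounds in the first.
        have hb : ∀ T' ⊆ s', f (insert a T) T' ≤ f T T' + c a := fun T' _ => by
          linarith [le_abs_self (f (insert a T) T' - f T T'), hf a ha T T']
        have hb' : ∀ T' ⊆ s', f T T' ≤ f (insert a T) T' + c a := fun T' _ => by
          linarith [neg_abs_le (f (insert a T) T' - f T T'), hf a ha T T']
        have i1 := expect_mono h0' h1' hb
        have i2 := expect_mono h0' h1' hb'
        rw [expect_add, expect_const] at i1 i2
        rw [abs_le]
        constructor <;> linarith
    _ = _ := by rw [← Real.exp_add]; congr 1; ring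

/-- Two-sided concentration for a function of two independent random subsets. -/
lemma expect_expect_tail_le {r : α → ℝ} (h0 : ∀ a, 0 ≤ r a) (h1 : ∀ a, r a ≤ 1)
    {r' : β → ℝ} (h0' : ∀ b, 0 ≤ r' b) (h1' : ∀ b, r' b ≤ 1) (c : α → ℝ) (c' : β → ℝ)
    (s : Finset α) (s' : Finset β) (f : Finset α → Finset β → ℝ)
    (hf : ∀ a ∈ s, ∀ T T', |f (insert a T) T' - f T T'| ≤ c a)
    (hf' : ∀ b ∈ s', ∀ T T', |f T (insert b T') - f T T'| ≤ c' b)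
    {θ : ℝ} (hθ : 0 ≤ θ) (hc1 : ∀ a ∈ s, θ * c a ≤ 1) (hc1' : ∀ b ∈ s', θ * c' b ≤ 1) (t : ℝ) :
    expect s r (fun T => expect s' r' fun T' =>
        if t < |f T T' - expect s r (fun T => expect s' r' (f T))| then 1 else 0) ≤
      2 * Real.exp (θ ^ 2 * (∑ a ∈ s, r a * c a ^ 2 + ∑ b ∈ s', r' b * c' b ^ 2) - θ * t) := by
  set m := expect s r (fun T => expect s' r' (f T)) with hm
  have key : ∀ σ : ℝ, |σ| = θ → expect s r (fun T => expect s' r' fun T' => Real.exp (σ * f T T'))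
      ≤ Real.exp (σ * m +
        θ ^ 2 * (∑ a ∈ s, r a * c a ^ 2 + ∑ b ∈ s', r' b * c' b ^ 2)) := by
    intro σ hσ
    have := expect_expect_exp_le h0 h1 h0' h1' (fun a => θ * c a) (fun b => θ * c' b) s s' hc1 hc1'
      (fun T T' => σ * f T T')
      (fun a ha T T' => by
        rw [← mul_sub, abs_mul, hσ]; exact mul_le_mul_of_nonneg_left (hf a ha T T') hθ)
      (fun b hb T T' => by
        rw [← mul_sub, abs_mul, hσ]; exact mul_le_mul_of_nonneg_left (hf' b hb T T') hθ)
    simp only [expect_const_mul, ← hm] at this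
    refine this.trans (le_of_eq ?_)
    rw [mul_add, Finset.mul_sum, Finset.mul_sum]
    congr 3 <;> exact Finset.sum_congr rfl fun _ _ => by ring
  have hp := key θ (abs_of_nonneg hθ)
  have hn := key (-θ) (by rw [abs_neg, abs_of_nonneg hθ])
  set V := ∑ a ∈ s, r a * c a ^ 2 + ∑ b ∈ s', r' b * c' b ^ 2
  -- Markov's inequality: the indicator is at most the sum of the exponentials for the upper and the
  -- lower tail.
  calc _ ≤ expect s r (fun T => expect s' r' fun T' =>
        Real.exp (-θ * m - θ * t) * Real.exp (θ * f T T')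
          + Real.exp (θ * m - θ * t) * Real.exp (-θ * f T T')) := by
        refine expect_mono h0 h1 fun T _ => expect_mono h0' h1' fun T' _ => ?_
        rw [← Real.exp_add, ← Real.exp_add]
        split_ifs with h
        · rcases lt_abs.1 h with h | h
          · have : 0 ≤ -θ * m - θ * t + θ * f T T' := by nlinarith
            linarith [Real.one_le_exp this, Real.exp_pos (θ * m - θ * t + -θ * f T T')]
          · have : 0 ≤ θ * m - θ * t + -θ * f T T' := by nlinarith
            linarith [Real.one_le_exp this, Real.exp_pos (-θ * m - θ * t + θ * f T T')]
        · positivity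
    _ = Real.exp (-θ * m - θ * t) * expect s r (fun T => expect s' r' fun T' => Real.exp (θ * f T T'))
        + Real.exp (θ * m - θ * t)
          * expect s r (fun T => expect s' r' fun T' => Real.exp (-θ * f T T')) := by
        simp only [expect_add, expect_const_mul]
    _ ≤ Real.exp (-θ * m - θ * t) * Real.exp (θ * m + θ ^ 2 * V)
        + Real.exp (θ * m - θ * t) * Real.exp (-θ * m + θ ^ 2 * V) :=
        add_le_add (mul_le_mul_of_nonneg_left hp (Real.exp_pos _).le)
          (mul_le_mul_of_nonneg_left hn (Real.exp_pos _).le)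
    _ = _ := by
        rw [← Real.exp_add, ← Real.exp_add, two_mul]
        congr 2 <;> ring

/-! ### Survivor counts and their concentration -/

/-- The number of `w ∈ W` whose obstruction sets `U w` and `F w` are both avoided. -/
def survivors (W : Finset ι) (U : ι → Finset α) (F : ι → Finset β) (T : Finset α)
    (T' : Finset β) : ℝ :=
  ∑ w ∈ W, (if Disjoint T (U w) then 1 else 0) * (if Disjoint T' (F w) then 1 else 0)

lemma survivors_eq_card (W : Finset ι) (U : ι → Finset α) (F : ι → Finset β) (T : Finset α)
    (T' : Finset β) : survivors W U F T T' =
      ((W.filter fun w => Disjoint T' (F w) ∧ Disjoint T (U w)).card : ℝ) := by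
  simp only [survivors, mul_ite, mul_one, mul_zero, ← ite_and]
  rw [Finset.sum_boole]

lemma expect_survivors {s : Finset α} {s' : Finset β} (r : α → ℝ) (r' : β → ℝ) (W : Finset ι)
    {U : ι → Finset α} {F : ι → Finset β} (hU : ∀ w ∈ W, U w ⊆ s) (hF : ∀ w ∈ W, F w ⊆ s') :
    expect s r (fun T => expect s' r' (survivors W U F T)) =
      ∑ w ∈ W, (∏ a ∈ U w, (1 - r a)) * ∏ b ∈ F w, (1 - r' b) := by
  have : ∀ T, survivors W U F T = fun T' => ∑ w ∈ W,
      (if Disjoint T (U w) then (1 : ℝ) else 0) * (if Disjoint T' (F w) then 1 else 0) :=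
    fun T => rfl
  simp only [this, expect_sum, expect_const_mul]
  refine Finset.sum_congr rfl fun w hw => ?_
  rw [expect_disjoint (hF w hw)]
  simp only [mul_comm _ (∏ b ∈ F w, (1 - r' b))]
  rw [expect_const_mul, expect_disjoint (hU w hw)]

lemma abs_indicator_insert_sub_le (a : α) (T B : Finset α) :
    |(if Disjoint (insert a T) B then (1 : ℝ) else 0) - (if Disjoint T B then 1 else 0)| ≤
      if a ∈ B then 1 else 0 := by
  simp only [Finset.disjoint_insert_left]
  by_cases h1 : a ∈ B <;> by_cases h2 : Disjoint T B <;> simp [h1, h2]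

/-- Double counting: ∑_w ∑_{a ∈ U w} r a weights each `a` by its degree. One of the two degree
factors on the left is bounded by `M`, leaving `M` times the expected number of hits as variance
proxy. -/
lemma sum_mul_sq_card_le {s : Finset α} {r : α → ℝ} (h0 : ∀ a, 0 ≤ r a) {W : Finset ι}
    {U : ι → Finset α} (hU : ∀ w ∈ W, U w ⊆ s) {M : ℝ}
    (hM : ∀ a ∈ s, ((W.filter fun w => a ∈ U w).card : ℝ) ≤ M) :
    ∑ a ∈ s, r a * ((W.filter fun w => a ∈ U w).card : ℝ) ^ 2 ≤ M * ∑ w ∈ W, ∑ a ∈ U w, r a := by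
  have e : ∑ w ∈ W, ∑ a ∈ U w, r a = ∑ a ∈ s, r a * ((W.filter fun w => a ∈ U w).card : ℝ) := by
    calc _ = ∑ w ∈ W, ∑ a ∈ s, if a ∈ U w then r a else 0 :=
          Finset.sum_congr rfl fun w hw => by
            rw [← Finset.sum_filter, Finset.filter_mem_eq_inter,
              Finset.inter_eq_right.2 (hU w hw)]
      _ = ∑ a ∈ s, ∑ w ∈ W, if a ∈ U w then r a else 0 := Finset.sum_comm
      _ = _ := Finset.sum_congr rfl fun a _ => by
          rw [← Finset.sum_filter, Finset.sum_const, nsmul_eq_mul, mul_comm]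
  rw [e, Finset.mul_sum]
  refine Finset.sum_le_sum fun a ha => ?_
  have : (0 : ℝ) ≤ r a * ((W.filter fun w => a ∈ U w).card : ℝ) :=
    mul_nonneg (h0 a) (Nat.cast_nonneg _)
  nlinarith [mul_le_mul_of_nonneg_left (hM a ha) this]

/-- Concentration of the number of survivors. -/
lemma survivors_tail_le {r : α → ℝ} (h0 : ∀ a, 0 ≤ r a) (h1 : ∀ a, r a ≤ 1)
    {r' : β → ℝ} (h0' : ∀ b, 0 ≤ r' b) (h1' : ∀ b, r' b ≤ 1)
    {s : Finset α} {s' : Finset β} {W : Finset ι}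
    {U : ι → Finset α} {F : ι → Finset β} (hU : ∀ w ∈ W, U w ⊆ s) (hF : ∀ w ∈ W, F w ⊆ s')
    {M θ : ℝ} (hM : ∀ a ∈ s, ((W.filter fun w => a ∈ U w).card : ℝ) ≤ M)
    (hM' : ∀ b ∈ s', ((W.filter fun w => b ∈ F w).card : ℝ) ≤ M)
    (hθ : 0 ≤ θ) (hθM : θ * M ≤ 1) (t : ℝ) :
    expect s r (fun T => expect s' r' fun T' =>
        if t < |survivors W U F T T' - ∑ w ∈ W, (∏ a ∈ U w, (1 - r a)) * ∏ b ∈ F w, (1 - r' b)|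
        then 1 else 0) ≤
      2 * Real.exp (θ ^ 2 * (M * ∑ w ∈ W, (∑ a ∈ U w, r a + ∑ b ∈ F w, r' b)) - θ * t) := by
  have h := expect_expect_tail_le h0 h1 h0' h1'
    (fun a => ((W.filter fun w => a ∈ U w).card : ℝ))
    (fun b => ((W.filter fun w => b ∈ F w).card : ℝ)) s s' (survivors W U F)
    (fun a _ T T' => by
      rw [survivors, survivors, ← Finset.sum_sub_distrib, Finset.card_filter, Nat.cast_sum]
      refine (Finset.abs_sum_le_sum_abs _ _).trans (Finset.sum_le_sum fun w _ => ?_)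
      rw [← sub_mul, abs_mul]
      refine (mul_le_of_le_one_right (abs_nonneg _) (by split_ifs <;> simp)).trans
        ((abs_indicator_insert_sub_le a T (U w)).trans (by split_ifs <;> simp)))
    (fun b _ T T' => by
      rw [survivors, survivors, ← Finset.sum_sub_distrib, Finset.card_filter, Nat.cast_sum]
      refine (Finset.abs_sum_le_sum_abs _ _).trans (Finset.sum_le_sum fun w _ => ?_)
      rw [← mul_sub, abs_mul]
      refine (mul_le_of_le_one_left (abs_nonneg _) (by split_ifs <;> simp)).trans
        ((abs_indicator_insert_sub_le b T' (F w)).trans (by split_ifs <;> simp)))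
    hθ (fun a ha => (mul_le_mul_of_nonneg_left (hM a ha) hθ).trans hθM)
    (fun b hb => (mul_le_mul_of_nonneg_left (hM' b hb) hθ).trans hθM) t
  rw [expect_survivors r r' W hU hF] at h
  refine h.trans (mul_le_mul_of_nonneg_left (Real.exp_le_exp.2 (sub_le_sub_right
    (mul_le_mul_of_nonneg_left ?_ (sq_nonneg θ)) _)) zero_le_two)
  rw [Finset.sum_add_distrib, mul_add]
  exact add_le_add (sum_mul_sq_card_le h0 hU hM) (sum_mul_sq_card_le h0' hF hM')

end Expect

/-! ### The random subsets of the algorithm -/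

lemma toReal_clamp (x : ℝ) : (clamp x : ℝ) = min (max x 0) 1 := by
  simp [clamp]

lemma toReal_clamp_of_mem {x : ℝ} (h0 : 0 ≤ x) (h1 : x ≤ 1) : (clamp x : ℝ) = x := by
  rw [toReal_clamp, max_eq_left h0, min_eq_left h1]

lemma clamp_le_one (x : ℝ) : (clamp x : ℝ) ≤ 1 := by
  rw [toReal_clamp]; exact min_le_right _ _

/-- The bridge from the `PMF` of a random subset to the finite real sum `expect`, in which all
estimates are made. -/
lemma tsum_randomSubset_mul {α : Type} [Fintype α] (s : Finset α) (r : α → ℝ)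
    {f : Finset α → ℝ} (hf : ∀ T, 0 ≤ f T) :
    ∑' T, randomSubset s r T * ENNReal.ofReal (f T) =
      ENNReal.ofReal (expect s (fun a => (clamp (r a) : ℝ)) f) := by
  have hv : ∀ T, randomSubset s r T = if T ⊆ s then
      (((∏ a ∈ T, clamp (r a)) * ∏ a ∈ s \ T, (1 - clamp (r a)) : NNReal) : ENNReal) else 0 :=
    fun T => rfl
  rw [tsum_eq_sum (s := s.powerset) (fun T hT => by
    rw [hv, if_neg (by simpa using hT), zero_mul])]
  rw [expect, ENNReal.ofReal_sum_of_nonneg (fun T _ => mul_nonneg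
    (weight_nonneg (fun a => NNReal.coe_nonneg _) (fun a => clamp_le_one _) T) (hf T))]
  refine Finset.sum_congr rfl fun T hT => ?_
  rw [hv, if_pos (Finset.mem_powerset.1 hT), ENNReal.ofReal_mul
    (weight_nonneg (fun a => NNReal.coe_nonneg _) (fun a => clamp_le_one _) T)]
  congr 1
  rw [← ENNReal.ofReal_coe_nnreal]
  congr 1
  push_cast
  congr 1
  refine Finset.prod_congr rfl fun a _ => ?_
  rw [NNReal.coe_sub (show clamp (r a) ≤ 1 from min_le_right _ _), NNReal.coe_one]

lemma toOuterMeasure_map_randomSubset {α γ : Type} [Fintype α] (s : Finset α) (r : α → ℝ)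
    (g : Finset α → γ) (Q : Set γ) :
    ((randomSubset s r).map g).toOuterMeasure Q =
      ENNReal.ofReal (expect s (fun a => (clamp (r a) : ℝ)) fun T => if g T ∈ Q then 1 else 0) := by
  rw [PMF.toOuterMeasure_map_apply, PMF.toOuterMeasure_apply,
    ← tsum_randomSubset_mul s r (fun T => by split_ifs <;> simp)]
  refine tsum_congr fun T => ?_
  by_cases h : g T ∈ Q <;> simp [h]

/-- Probabilities of the next state as iterated expectations. -/
lemma toOuterMeasure_step {n : ℕ} (p : ℝ) (sel : Finset (Finset (Fin n)) → Finset (Finset (Fin n)))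
    (i : ℕ) (s : State n) (Q : Set (State n)) :
    (step p sel i s).toOuterMeasure Q = ENNReal.ofReal
      (expect (cliqueExt s.graph ∅ (kAt n p i)) (fun _ => (clamp (qAt n p i) : ℝ)) fun Γ =>
        expect s.graph.edgeFinset (fun e => (clamp (zetaAt p i s.graph e) : ℝ)) fun S =>
          if nextState s Γ S (sel Γ) ∈ Q then 1 else 0) := by
  rw [step, PMF.toOuterMeasure_bind_apply, ← tsum_randomSubset_mul _ _ (fun Γ => expect_nonneg
    (fun a => NNReal.coe_nonneg _) (fun a => clamp_le_one _) fun S _ => by split_ifs <;> simp)]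
  refine tsum_congr fun Γ => ?_
  rw [toOuterMeasure_map_randomSubset]

/-! ### Counting clique extensions -/

/-- The set of common neighbours of `S` outside `S`. -/
def commonNbrSet {n : ℕ} (G : SimpleGraph (Fin n)) (S : Finset (Fin n)) : Finset (Fin n) :=
  Finset.univ.filter fun w => w ∉ S ∧ ∀ v ∈ S, G.Adj v w

lemma mem_commonNbrSet {n : ℕ} {G : SimpleGraph (Fin n)} {S : Finset (Fin n)} {w : Fin n} :
    w ∈ commonNbrSet G S ↔ w ∉ S ∧ ∀ v ∈ S, G.Adj v w := by
  simp [commonNbrSet]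

lemma card_commonNbrSet {n : ℕ} (G : SimpleGraph (Fin n)) (S : Finset (Fin n)) :
    (commonNbrSet G S).card = commonNbrs G S := by
  rw [commonNbrs, commonNbrSet]

lemma mem_cliqueExt {n : ℕ} {G : SimpleGraph (Fin n)} {S J : Finset (Fin n)} {j : ℕ} :
    J ∈ cliqueExt G S j ↔ S ⊆ J ∧ J.card = j ∧
      ∀ x ∈ J, ∀ y ∈ J, x ≠ y → ¬ (x ∈ S ∧ y ∈ S) → G.Adj x y := by
  simp [cliqueExt]

lemma cliqueExt_card_self {n : ℕ} (G : SimpleGraph (Fin n)) (S : Finset (Fin n)) :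
    cliqueExt G S S.card = {S} := by
  ext J
  rw [mem_cliqueExt, Finset.mem_singleton]
  constructor
  · rintro ⟨h1, h2, -⟩
    exact (Finset.eq_of_subset_of_card_le h1 h2.le).symm
  · rintro rfl
    exact ⟨subset_rfl, rfl, fun x hx y hy _ h => absurd ⟨hx, hy⟩ h⟩

/-- The pairs of J exempted by `insert w S` but not by `S` are those joining w to S, and these are
edges precisely because w is a common neighbour. -/
lemma mem_cliqueExt_insert_iff {n : ℕ} {G : SimpleGraph (Fin n)} {S J : Finset (Fin n)} {j : ℕ}
    {w : Fin n} : (w ∈ commonNbrSet G S ∧ J ∈ cliqueExt G (insert w S) j) ↔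
      (J ∈ cliqueExt G S j ∧ w ∈ J \ S) := by
  simp only [mem_commonNbrSet, mem_cliqueExt, Finset.mem_sdiff, Finset.insert_subset_iff,
    Finset.mem_insert]
  constructor
  · rintro ⟨⟨hw, hadj⟩, ⟨hwJ, hS⟩, hc, h⟩
    refine ⟨⟨hS, hc, fun x hx y hy hxy hn => ?_⟩, hwJ, hw⟩
    by_cases hxw : x = w
    · by_cases hyS : y ∈ S
      · exact hxw ▸ (hadj y hyS).symm
      · exact h x hx y hy hxy (by grind)
    · by_cases hyw : y = w
      · by_cases hxS : x ∈ S
        · exact hyw ▸ hadj x hxS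
        · exact h x hx y hy hxy (by grind)
      · exact h x hx y hy hxy (by grind)
  · rintro ⟨⟨hS, hc, h⟩, hwJ, hw⟩
    exact ⟨⟨hw, fun v hv => h v (hS hv) w hwJ (by grind) (by grind)⟩, ⟨hwJ, hS⟩, hc,
      fun x hx y hy hxy hn => h x hx y hy hxy (by grind)⟩

/-- Every clique extension of `S` arises from `j - |S|` extensions of some `S ∪ {w}`. -/
lemma sub_mul_card_cliqueExt {n : ℕ} (G : SimpleGraph (Fin n)) (S : Finset (Fin n)) (j : ℕ) :
    (j - S.card) * (cliqueExt G S j).card =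
      ∑ w ∈ commonNbrSet G S, (cliqueExt G (insert w S) j).card := by
  have h1 : ∑ J ∈ cliqueExt G S j, (J \ S).card = (j - S.card) * (cliqueExt G S j).card := by
    rw [Finset.sum_congr rfl (g := fun _ => j - S.card), Finset.sum_const, smul_eq_mul, mul_comm]
    intro J hJ
    rw [mem_cliqueExt] at hJ
    rw [Finset.card_sdiff_of_subset hJ.1, hJ.2.1]
  rw [← h1, ← Finset.card_sigma, ← Finset.card_sigma]
  refine Finset.card_bij' (fun x _ => ⟨x.2, x.1⟩) (fun x _ => ⟨x.2, x.1⟩) ?_ ?_ ?_ ?_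
  · rintro ⟨J, w⟩ h
    rw [Finset.mem_sigma] at h ⊢
    exact mem_cliqueExt_insert_iff.2 h
  · rintro ⟨w, J⟩ h
    rw [Finset.mem_sigma] at h ⊢
    exact mem_cliqueExt_insert_iff.1 h
  · intros; rfl
  · intros; rfl

lemma muAt_self (n : ℕ) (p : ℝ) (s i : ℕ) : muAt n p s s i = 1 := by
  simp [muAt]

lemma pAt_pos {n : ℕ} {p : ℝ} (hp : 0 < p) (i : ℕ) : 0 < pAt n p i :=
  mul_pos hp (Real.exp_pos _)

/-- The counterpart for μ of `sub_mul_card_cliqueExt`: absorption for binomial coefficients,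
together with C(s+1,2) = s + C(s,2) in the exponent of p_i. -/
lemma sub_mul_muAt {n : ℕ} (p : ℝ) {s j : ℕ} (i : ℕ) (hsj : s < j) (hjn : j ≤ n) :
    ((j : ℝ) - s) * muAt n p s j i = lambdaAt n p s i * muAt n p (s + 1) j i := by
  obtain ⟨d, rfl⟩ : ∃ d, j = s + 1 + d := ⟨j - s - 1, by omega⟩
  obtain ⟨m, rfl⟩ : ∃ m, n = s + 1 + d + m := ⟨n - (s + 1 + d), by omega⟩
  have hch : (s + 1).choose 2 ≤ (s + 1 + d).choose 2 := Nat.choose_le_choose 2 (by omega)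
  have hs2 : (s + 1).choose 2 = s + s.choose 2 := by
    rw [Nat.choose_succ_succ' s 1, Nat.choose_one_right]
  have e : (s + 1 + d).choose 2 - s.choose 2 = s + ((s + 1 + d).choose 2 - (s + 1).choose 2) := by
    omega
  have hc := Nat.add_one_mul_choose_eq (d + m) d
  have hc' : ((d : ℝ) + m + 1) * ((d + m).choose d : ℝ) = ((d + m + 1).choose (d + 1) : ℝ) * (d + 1) := by
    exact_mod_cast hc
  have e1 : s + 1 + d + m - s = d + m + 1 := by omega
  have e2 : s + 1 + d - s = d + 1 := by omega
  have e3 : s + 1 + d + m - (s + 1) = d + m := by omega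
  have e4 : s + 1 + d - (s + 1) = d := by omega
  rw [muAt, muAt, lambdaAt, e, pow_add, e1, e2, e3, e4]
  push_cast
  linear_combination (pAt (s + 1 + d + m) p i ^ s
    * pAt (s + 1 + d + m) p i ^ ((s + 1 + d).choose 2 - (s + 1).choose 2)) * (-hc')

lemma muAt_nonneg {n : ℕ} {p : ℝ} (hp : 0 < p) (s j i : ℕ) : 0 ≤ muAt n p s j i :=
  mul_nonneg (Nat.cast_nonneg _) (pow_nonneg (pAt_pos hp i).le _)

lemma lambdaAt_nonneg {n : ℕ} {p : ℝ} (hp : 0 < p) {s : ℕ} (i : ℕ) (hs : s ≤ n) :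
    0 ≤ lambdaAt n p s i :=
  mul_nonneg (sub_nonneg.2 (Nat.cast_le.2 hs)) (pow_nonneg (pAt_pos hp i).le _)

/-- Relative errors in the common-neighbour counts multiply up in the clique counts. -/
lemma card_cliqueExt_bounds {n : ℕ} {p : ℝ} (hp : 0 < p) (i : ℕ) {k : ℕ} (hk : k ≤ n)
    {δ : ℝ} (hδ0 : 0 ≤ δ) (hδ1 : δ ≤ 1) {G : SimpleGraph (Fin n)}
    (hG : ∀ S : Finset (Fin n), S.card + 1 ≤ k →
      |(commonNbrs G S : ℝ) - lambdaAt n p S.card i| ≤ δ * lambdaAt n p S.card i)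
    (d : ℕ) (S : Finset (Fin n)) (hS : S.card + d ≤ k) :
    (1 - δ) ^ d * muAt n p S.card (S.card + d) i ≤ ((cliqueExt G S (S.card + d)).card : ℝ) ∧
      ((cliqueExt G S (S.card + d)).card : ℝ) ≤ (1 + δ) ^ d * muAt n p S.card (S.card + d) i := by
  induction d generalizing S with
  | zero => simp [muAt_self, cliqueExt_card_self]
  | succ d ih =>
    have hrec := sub_mul_card_cliqueExt G S (S.card + (d + 1))
    rw [Nat.add_sub_cancel_left] at hrec
    have hrec' : ((d : ℝ) + 1) * ((cliqueExt G S (S.card + (d + 1))).card : ℝ) =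
        ∑ w ∈ commonNbrSet G S, ((cliqueExt G (insert w S) (S.card + (d + 1))).card : ℝ) := by
      exact_mod_cast hrec
    have hmu := sub_mul_muAt (n := n) p (s := S.card) (j := S.card + (d + 1)) i (by omega) (by omega)
    set μ' := muAt n p (S.card + 1) (S.card + (d + 1)) i with hμ'
    set μ := muAt n p S.card (S.card + (d + 1)) i
    set L := lambdaAt n p S.card i
    have hmu' : ((d : ℝ) + 1) * μ = L * μ' := by
      rw [← hmu]; push_cast; ring
    have hb : ∀ w ∈ commonNbrSet G S,
        (1 - δ) ^ d * μ' ≤ ((cliqueExt G (insert w S) (S.card + (d + 1))).card : ℝ) ∧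
        ((cliqueExt G (insert w S) (S.card + (d + 1))).card : ℝ) ≤ (1 + δ) ^ d * μ' := by
      intro w hw
      have hc : (insert w S).card = S.card + 1 :=
        Finset.card_insert_of_notMem (mem_commonNbrSet.1 hw).1
      have := ih (insert w S) (by omega)
      rw [hc, show S.card + 1 + d = S.card + (d + 1) by omega] at this
      exact this
    have hN := hG S (by omega)
    rw [← card_commonNbrSet, abs_le] at hN
    have hμ0 : 0 ≤ μ' := muAt_nonneg hp _ _ _
    have hL0 : 0 ≤ L := lambdaAt_nonneg hp i (by omega)
    have hd : (0 : ℝ) < (d : ℝ) + 1 := by positivity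
    have h1δ : 0 ≤ 1 - δ := sub_nonneg.2 hδ1
    have hlow : ((commonNbrSet G S).card : ℝ) * ((1 - δ) ^ d * μ') ≤
        ∑ w ∈ commonNbrSet G S, ((cliqueExt G (insert w S) (S.card + (d + 1))).card : ℝ) := by
      rw [← nsmul_eq_mul]
      exact Finset.card_nsmul_le_sum _ _ _ fun w hw => (hb w hw).1
    have hupp : ∑ w ∈ commonNbrSet G S, ((cliqueExt G (insert w S) (S.card + (d + 1))).card : ℝ) ≤
        ((commonNbrSet G S).card : ℝ) * ((1 + δ) ^ d * μ') := by
      rw [← nsmul_eq_mul]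
      exact Finset.sum_le_card_nsmul _ _ _ fun w hw => (hb w hw).2
    constructor
    · refine le_of_mul_le_mul_left ?_ hd
      rw [hrec']
      refine le_trans (le_of_eq ?_) ((mul_le_mul_of_nonneg_right (show (1 - δ) * L ≤ _ by linarith)
        (mul_nonneg (pow_nonneg h1δ d) hμ0)).trans hlow)
      linear_combination (1 - δ) ^ (d + 1) * hmu'
    · refine le_of_mul_le_mul_left ?_ hd
      rw [hrec']
      refine (hupp.trans (mul_le_mul_of_nonneg_right (show _ ≤ (1 + δ) * L by linarith)
        (mul_nonneg (by positivity) hμ0))).trans (le_of_eq ?_)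
      linear_combination -(1 + δ) ^ (d + 1) * hmu'

/-- Follows from (1+δ)^d ≤ e^{dδ} ≤ 1 + dδ + (dδ)². -/
lemma one_add_pow_le {δ : ℝ} (hδ : 0 ≤ δ) {d : ℕ} (hd : d * δ ≤ 1) : (1 + δ) ^ d ≤ 1 + 2 * (d * δ) := by
  have h1 : (1 + δ) ^ d ≤ Real.exp (d * δ) := by
    rw [Real.exp_nat_mul]
    exact pow_le_pow_left₀ (by linarith) (by linarith [Real.add_one_le_exp δ]) d
  have h0 : 0 ≤ (d : ℝ) * δ := by positivity
  have h2 := Real.abs_exp_sub_one_sub_id_le (x := d * δ) (by rwa [abs_of_nonneg h0])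
  have := le_abs_self (Real.exp (d * δ) - 1 - d * δ)
  nlinarith

/-- The neighbourhood estimates imply the clique estimates. -/
lemma cliqueEvent_of_nbrEvent {n : ℕ} {p : ℝ} (hp : 0 < p) {i : ℕ} (hk : kAt n p i ≤ n)
    (heps : 0 ≤ eps n) (heps1 : eps n ≤ 1)
    (hδ : 2 * (kAt n p i * (((i : ℝ) + 1) * eps n ^ 2)) ≤ eps n)
    {G : SimpleGraph (Fin n)} (hG : NbrEvent p i G) : CliqueEvent p i G := by
  intro S j hSj hj
  obtain ⟨d, rfl⟩ : ∃ d, j = S.card + d := ⟨j - S.card, by omega⟩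
  set δ := ((i : ℝ) + 1) * eps n ^ 2
  have hδ0 : 0 ≤ δ := by positivity
  have hdk : (d : ℝ) ≤ kAt n p i := by exact_mod_cast (by omega : d ≤ kAt n p i)
  have hdδ : 2 * (d * δ) ≤ eps n := by
    have := mul_le_mul_of_nonneg_right hdk hδ0
    linarith
  have hμ := muAt_nonneg (n := n) hp S.card (S.card + d) i
  -- The case d = 0 is separate because δ ≤ 1 is deduced below from 2dδ ≤ ε ≤ 1.
  rcases Nat.eq_zero_or_pos d with rfl | hd
  · simp only [add_zero, muAt_self, cliqueExt_card_self]
    simpa using heps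
  have hd1 : (1 : ℝ) ≤ d := by exact_mod_cast hd
  have hδ1 : δ ≤ 1 := by nlinarith
  obtain ⟨h1, h2⟩ := card_cliqueExt_bounds hp i hk hδ0 hδ1 hG d S hj
  have b1 : 1 + (d : ℝ) * (-δ) ≤ (1 + -δ) ^ d := one_add_mul_le_pow (by linarith) d
  have b2 := one_add_pow_le hδ0 (d := d) (by linarith)
  have b3 : 0 ≤ (d : ℝ) * δ := by positivity
  rw [← sub_eq_add_neg] at b1
  have c1 : (1 - eps n) * muAt n p S.card (S.card + d) i ≤
      (1 - δ) ^ d * muAt n p S.card (S.card + d) i :=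
    mul_le_mul_of_nonneg_right (by linarith) hμ
  have c2 : (1 + δ) ^ d * muAt n p S.card (S.card + d) i ≤
      (1 + eps n) * muAt n p S.card (S.card + d) i :=
    mul_le_mul_of_nonneg_right (by linarith) hμ
  rw [abs_le]
  constructor <;> linarith

/-! ### Estimates for the parameters -/

/-- The ninth root `n^{1/9}`, the inverse of `ε`. -/
def ninthRoot (n : ℕ) : ℝ := (n : ℝ) ^ (1 / 9 : ℝ)

lemma eps_eq_inv (n : ℕ) : eps n = (ninthRoot n)⁻¹ := by
  rw [eps, ninthRoot, Real.rpow_neg (Nat.cast_nonneg n)]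

lemma ninthRoot_pow (n : ℕ) : ninthRoot n ^ 9 = n := by
  rw [ninthRoot, ← Real.rpow_natCast, ← Real.rpow_mul (Nat.cast_nonneg n)]
  norm_num

lemma cliqueSize_mono {n : ℕ} {x x' : ℝ} (hn : 1 ≤ n) (h0 : 0 < x) (hxx' : x ≤ x') (h1 : x' < 1) :
    cliqueSize n x ≤ cliqueSize n x' := by
  refine Nat.ceil_mono (mul_le_mul_of_nonneg_left ?_ (by norm_num))
  have hlx' : 0 < Real.log (1 / x') := Real.log_pos (by rw [lt_div_iff₀ (h0.trans_le hxx')]; linarith)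
  exact div_le_div_of_nonneg_left (Real.log_nonneg (by exact_mod_cast hn)) hlx'
    (Real.log_le_log (one_div_pos.2 (h0.trans_le hxx')) (one_div_le_one_div_of_le h0 hxx'))

/-- Here (1/9) log_{1/x} n ≥ 81/18 > 2. Size at least 3 makes the clique estimates for |S| = 3
available. -/
lemma three_le_cliqueSize {n : ℕ} {x : ℝ} (hn : 2 ≤ n) (h1 : x < 1)
    (hx : (n : ℝ) ^ (-(2 / 81) : ℝ) ≤ x) : 3 ≤ cliqueSize n x := by
  have hn0 : (0 : ℝ) < n := by exact_mod_cast (by omega : 0 < n)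
  have h0 : 0 < x := (Real.rpow_pos_of_pos hn0 _).trans_le hx
  have hlog : 0 < Real.log n := Real.log_pos (by exact_mod_cast hn)
  have hl : 0 < Real.log (1 / x) := Real.log_pos (by rw [lt_div_iff₀ h0]; linarith)
  have hl2 : Real.log (1 / x) ≤ 2 / 81 * Real.log n := by
    have := Real.log_le_log (Real.rpow_pos_of_pos hn0 _) hx
    rw [Real.log_rpow hn0] at this
    rw [one_div, Real.log_inv]
    linarith
  rw [cliqueSize, Nat.succ_le_iff, Nat.lt_ceil, Real.logb]
  rw [← mul_div_assoc, lt_div_iff₀ hl]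
  push_cast
  linarith

/-- By definition of the ceiling, s is strictly below (1/9) log_{1/x} n, i.e. x^s > n^{-1/9}. -/
lemma eps_le_pow {n : ℕ} {x : ℝ} (hn : 2 ≤ n) (h0 : 0 < x) (h1 : x < 1) {s : ℕ}
    (hs : s + 1 ≤ cliqueSize n x) : eps n ≤ x ^ s := by
  have hn0 : (0 : ℝ) < n := by exact_mod_cast (by omega : 0 < n)
  have hl : 0 < Real.log (1 / x) := Real.log_pos (by rw [lt_div_iff₀ h0]; linarith)
  rw [Nat.succ_le_iff, cliqueSize, Nat.lt_ceil, Real.logb, ← mul_div_assoc, lt_div_iff₀ hl, one_div,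
    Real.log_inv] at hs
  rw [eps, Real.rpow_def_of_pos hn0, ← Real.exp_log (pow_pos h0 s), Real.exp_le_exp, Real.log_pow]
  norm_num at hs ⊢
  linarith

/-- The range of parameters in which all the estimates hold. -/
structure Regime (n : ℕ) (p : ℝ) : Prop where
  two_le : 2 ≤ n
  lt_one : p < 1
  le_prob : (n : ℝ) ^ (-(1 / 81) : ℝ) ≤ p
  pow_le : 3 * (cliqueSize n p : ℝ) ^ 9 ≤ (n : ℝ) ^ (1 / 81 : ℝ)

namespace Regime

variable {n : ℕ} {p : ℝ}

lemma cast_pos (h : Regime n p) : (0 : ℝ) < n := by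
  have := h.two_le
  exact_mod_cast (by omega : 0 < n)

lemma pos (h : Regime n p) : 0 < p := (Real.rpow_pos_of_pos h.cast_pos _).trans_le h.le_prob

lemma three_le (h : Regime n p) : 3 ≤ cliqueSize n p :=
  three_le_cliqueSize h.two_le h.lt_one ((Real.rpow_le_rpow_of_exponent_le
    (by exact_mod_cast (by have := h.two_le; omega : 1 ≤ n)) (by norm_num)).trans h.le_prob)

lemma three_le_cast (h : Regime n p) : (3 : ℝ) ≤ cliqueSize n p := by exact_mod_cast h.three_le

/-- The ninth power of `pow_le`, with 3^9 = 19683. The bound is generous: later uses involve at most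
the power k^11. -/
lemma pow_le_ninthRoot (h : Regime n p) : 10000 * (cliqueSize n p : ℝ) ^ 20 ≤ ninthRoot n := by
  have h3 := h.three_le_cast
  set k : ℝ := (cliqueSize n p : ℝ)
  have e : ninthRoot n = ((n : ℝ) ^ (1 / 81 : ℝ)) ^ 9 := by
    rw [ninthRoot, ← Real.rpow_natCast, ← Real.rpow_mul (Nat.cast_nonneg n)]
    norm_num
  rw [e]
  calc 10000 * k ^ 20 ≤ 19683 * k ^ 81 := by
        have : k ^ 20 ≤ k ^ 81 := pow_le_pow_right₀ (by linarith) (by norm_num)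
        have : 0 ≤ k ^ 81 := by positivity
        linarith
    _ = (3 * k ^ 9) ^ 9 := by ring
    _ ≤ _ := pow_le_pow_left₀ (by positivity) h.pow_le 9

/-- Multiples of lower powers of `k` are also below `n^{1/9}`. -/
lemma mul_pow_le_ninthRoot (h : Regime n p) {c : ℝ} (hc : c ≤ 10000) {m : ℕ}
    (hm : m ≤ 20) : c * (cliqueSize n p : ℝ) ^ m ≤ ninthRoot n := by
  have h3 := h.three_le_cast
  refine le_trans ?_ h.pow_le_ninthRoot
  exact mul_le_mul hc (pow_le_pow_right₀ (by linarith) hm) (by positivity) (by norm_num)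

lemma le_ninthRoot (h : Regime n p) : 10000 ≤ ninthRoot n := by
  simpa using h.mul_pow_le_ninthRoot (c := 10000) (m := 0) le_rfl (by norm_num)

lemma ninthRoot_pos (h : Regime n p) : 0 < ninthRoot n := by linarith [h.le_ninthRoot]

lemma eps_pos (h : Regime n p) : 0 < eps n := Real.rpow_pos_of_pos h.cast_pos _

lemma eps_le_one (h : Regime n p) : eps n ≤ 1 := by
  rw [eps_eq_inv]
  exact inv_le_one_of_one_le₀ (by linarith [h.le_ninthRoot])

lemma numSteps_add_one_le (h : Regime n p) :
    (numSteps n p : ℝ) + 1 ≤ 10 * (cliqueSize n p : ℝ) ^ 10 := by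
  have h3 := h.three_le_cast
  have hlog : 0 ≤ Real.log (cliqueSize n p) := Real.log_nonneg (by linarith)
  have h1 : (numSteps n p : ℝ) < 9 * (cliqueSize n p : ℝ) ^ 9 * Real.log (cliqueSize n p) + 1 :=
    Nat.ceil_lt_add_one (by positivity)
  have h2 : Real.log (cliqueSize n p) ≤ cliqueSize n p := by
    linarith [Real.log_le_sub_one_of_pos (show (0 : ℝ) < cliqueSize n p by linarith)]
  set k : ℝ := (cliqueSize n p : ℝ)
  have h4 : 9 * k ^ 9 * Real.log k ≤ 9 * k ^ 9 * k :=
    mul_le_mul_of_nonneg_left h2 (by positivity)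
  have h5 : k ^ 1 ≤ k ^ 10 := pow_le_pow_right₀ (by linarith) (by norm_num)
  have h6 : 9 * k ^ 9 * k = 9 * k ^ 10 := by ring
  linarith

lemma pAt_lt_one (h : Regime n p) (i : ℕ) : pAt n p i < 1 := by
  refine lt_of_le_of_lt (mul_le_of_le_one_right h.pos.le (Real.exp_le_one_iff.2 ?_)) h.lt_one
  exact div_nonpos_of_nonpos_of_nonneg (neg_nonpos.2 (Nat.cast_nonneg i)) (by positivity)

lemma pAt_zero : pAt n p 0 = p := by simp [pAt]

lemma pAt_succ (n : ℕ) (p : ℝ) (i : ℕ) :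
    pAt n p (i + 1) = pAt n p i * Real.exp (-(1 / (cliqueSize n p : ℝ) ^ 9)) := by
  rw [pAt, pAt, mul_assoc, ← Real.exp_add]
  congr 2
  push_cast
  ring

lemma pAt_succ_le (h : Regime n p) (i : ℕ) : pAt n p (i + 1) ≤ pAt n p i := by
  rw [pAt_succ]
  refine mul_le_of_le_one_right (pAt_pos h.pos i).le (Real.exp_le_one_iff.2 ?_)
  exact neg_nonpos.2 (by positivity)

lemma kAt_succ_le (h : Regime n p) (i : ℕ) : kAt n p (i + 1) ≤ kAt n p i :=
  cliqueSize_mono (by have := h.two_le; omega) (pAt_pos h.pos _) (h.pAt_succ_le i) (h.pAt_lt_one i)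

lemma kAt_le (h : Regime n p) (i : ℕ) : kAt n p i ≤ cliqueSize n p := by
  induction i with
  | zero => rw [kAt, pAt_zero]
  | succ i ih => exact (h.kAt_succ_le i).trans ih

lemma kAt_le_cast (h : Regime n p) (i : ℕ) : (kAt n p i : ℝ) ≤ cliqueSize n p := by
  exact_mod_cast h.kAt_le i

/-- Up to time I the density shrinks by a factor at most e^{9 log k + 1} = e k^9 ≤ 3k^9 ≤ n^{1/81},
so p_i ≥ n^{-2/81}. This is what the constant 3 in `pow_le` is for. -/
lemma three_le_kAt (h : Regime n p) {i : ℕ} (hi : i ≤ numSteps n p) : 3 ≤ kAt n p i := by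
  refine three_le_cliqueSize h.two_le (h.pAt_lt_one i) ?_
  have h3 := h.three_le_cast
  have hk := h.pow_le
  have hlog : 0 ≤ Real.log (cliqueSize n p) := Real.log_nonneg (by linarith)
  have h1 : (numSteps n p : ℝ) < 9 * (cliqueSize n p : ℝ) ^ 9 * Real.log (cliqueSize n p) + 1 :=
    Nat.ceil_lt_add_one (by positivity)
  have hi' : (i : ℝ) ≤ numSteps n p := by exact_mod_cast hi
  set k : ℝ := (cliqueSize n p : ℝ)
  set z : ℝ := (n : ℝ) ^ (1 / 81 : ℝ) with hz
  have hz0 : 0 < z := Real.rpow_pos_of_pos h.cast_pos _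
  have hk9 : 1 ≤ k ^ 9 := one_le_pow₀ (by linarith)
  have hkp : 0 < k := by linarith
  have hdiv : (i : ℝ) / k ^ 9 ≤ 9 * Real.log k + 1 := by
    rw [div_le_iff₀ (by positivity)]
    nlinarith
  have hexp : z⁻¹ ≤ Real.exp (-(i : ℝ) / k ^ 9) := by
    have e1 : Real.exp (9 * Real.log k + 1) = k ^ 9 * Real.exp 1 := by
      rw [Real.exp_add, show (9 : ℝ) * Real.log k = ((9 : ℕ) : ℝ) * Real.log k by norm_num,
        Real.exp_nat_mul, Real.exp_log hkp]
    have e2 : Real.exp ((i : ℝ) / k ^ 9) ≤ z := by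
      refine (Real.exp_le_exp.2 hdiv).trans (e1.le.trans (le_trans ?_ hk))
      have := Real.exp_one_lt_d9
      nlinarith
    rw [neg_div, Real.exp_neg]
    exact inv_anti₀ (Real.exp_pos _) e2
  have e3 : (n : ℝ) ^ (-(2 / 81) : ℝ) = (n : ℝ) ^ (-(1 / 81) : ℝ) * z⁻¹ := by
    rw [hz, ← Real.rpow_neg h.cast_pos.le, ← Real.rpow_add h.cast_pos]
    norm_num
  rw [e3, pAt]
  exact mul_le_mul h.le_prob hexp (inv_nonneg.2 hz0.le) h.pos.le

lemma two_mul_cliqueSize_le (h : Regime n p) : 2 * (cliqueSize n p : ℝ) ≤ n := by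
  have h1 := h.mul_pow_le_ninthRoot (c := 2) (m := 1) (by norm_num) (by norm_num)
  have h2 : ninthRoot n ^ 1 ≤ ninthRoot n ^ 9 :=
    pow_le_pow_right₀ (by linarith [h.le_ninthRoot]) (by norm_num)
  rw [ninthRoot_pow] at h2
  linarith

lemma kAt_le_n (h : Regime n p) (i : ℕ) : kAt n p i ≤ n := by
  have h1 := h.two_mul_cliqueSize_le
  have h2 := h.kAt_le_cast i
  have h3 := h.three_le_cast
  exact_mod_cast (by linarith : (kAt n p i : ℝ) ≤ n)

/-- Combines n - s ≥ n/2 with p_i^s ≥ ε. This polynomial lower bound drives both the comparison of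
μ_3 with μ_2 and the concentration. -/
lemma le_lambdaAt (h : Regime n p) {s i : ℕ} (hs : s + 1 ≤ kAt n p i) :
    ninthRoot n ^ 8 / 2 ≤ lambdaAt n p s i := by
  have h1 := eps_le_pow h.two_le (pAt_pos h.pos i) (h.pAt_lt_one i) hs
  have h2 := h.two_mul_cliqueSize_le
  have hs' : (s : ℝ) ≤ cliqueSize n p := by
    exact_mod_cast (by have := h.kAt_le i; omega : s ≤ cliqueSize n p)
  have hy := h.ninthRoot_pos
  rw [eps_eq_inv] at h1
  have h4 : (n : ℝ) / 2 ≤ n - s := by linarith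
  have h5 := mul_le_mul h4 h1 (inv_nonneg.2 hy.le) (by linarith [h.cast_pos])
  refine le_trans (le_of_eq ?_) h5
  rw [← ninthRoot_pow n]
  field_simp

/-- Run the recursion for μ down from μ_{j,j} = 1: each step multiplies by λ/(j-s) ≥ 1. -/
lemma one_le_muAt (h : Regime n p) {i : ℕ} (d s : ℕ) (hd : s + d ≤ kAt n p i) :
    1 ≤ muAt n p s (s + d) i := by
  induction d generalizing s with
  | zero => simp [muAt_self]
  | succ d ih =>
    have h1 := ih (s + 1) (by omega)
    rw [show s + 1 + d = s + (d + 1) by omega] at h1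
    have h2 := sub_mul_muAt (n := n) p (s := s) (j := s + (d + 1)) i (by omega)
      (hd.trans (h.kAt_le_n i))
    have h3 := h.le_lambdaAt (s := s) (i := i) (by omega)
    have h4 := h.mul_pow_le_ninthRoot (c := 2) (m := 1) (by norm_num) (by norm_num)
    have h5 : ninthRoot n ^ 1 ≤ ninthRoot n ^ 8 :=
      pow_le_pow_right₀ (by linarith [h.le_ninthRoot]) (by norm_num)
    have h6 : ((d : ℝ) + 1) ≤ cliqueSize n p := by
      exact_mod_cast (by have := h.kAt_le i; omega : d + 1 ≤ cliqueSize n p)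
    have hd0 : (0 : ℝ) < (d : ℝ) + 1 := by positivity
    push_cast at h2
    rw [show (s : ℝ) + (d + 1) - s = d + 1 by ring] at h2
    have h7 : ((d : ℝ) + 1) ≤ lambdaAt n p s i := by linarith
    refine le_of_mul_le_mul_left ?_ hd0
    rw [h2, mul_one]
    nlinarith

/-- The recursion at s = 2. It shows that fixing a third vertex costs a factor of about n^{8/9}, so
cliques through two given edges at w are negligible. -/
lemma muAt_three_le (h : Regime n p) {i : ℕ} (hi : i ≤ numSteps n p) :
    ninthRoot n ^ 8 * muAt n p 3 (kAt n p i) i ≤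
      2 * cliqueSize n p * muAt n p 2 (kAt n p i) i := by
  have h3 := h.three_le_kAt hi
  have h2 := sub_mul_muAt (n := n) p (s := 2) (j := kAt n p i) i (by omega) (h.kAt_le_n i)
  have h4 := mul_le_mul_of_nonneg_right (h.le_lambdaAt (s := 2) (i := i) (by omega))
    (muAt_nonneg (n := n) h.pos 3 (kAt n p i) i)
  have h5 := h.kAt_le_cast i
  have h6 := muAt_nonneg (n := n) h.pos 2 (kAt n p i) i
  push_cast at h2
  nlinarith

lemma le_muAt_two (h : Regime n p) {i : ℕ} (hi : i ≤ numSteps n p) :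
    ninthRoot n ^ 8 ≤ 2 * cliqueSize n p * muAt n p 2 (kAt n p i) i := by
  refine le_trans ?_ (h.muAt_three_le hi)
  have h3 := h.three_le_kAt hi
  have h1 := h.one_le_muAt (i := i) (kAt n p i - 3) 3 (by omega)
  rw [show 3 + (kAt n p i - 3) = kAt n p i by omega] at h1
  exact le_mul_of_one_le_right (pow_nonneg h.ninthRoot_pos.le _) h1

lemma muAt_two_pos (h : Regime n p) {i : ℕ} (hi : i ≤ numSteps n p) :
    0 < muAt n p 2 (kAt n p i) i := by
  have h3 := h.three_le_kAt hi
  have h1 := h.one_le_muAt (i := i) (kAt n p i - 2) 2 (by omega)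
  rw [show 2 + (kAt n p i - 2) = kAt n p i by omega] at h1
  linarith

lemma qAt_pos (h : Regime n p) {i : ℕ} (hi : i ≤ numSteps n p) : 0 < qAt n p i := by
  have h1 := h.muAt_two_pos hi
  have h2 := h.eps_pos
  have h3 := h.three_le_cast
  unfold qAt
  positivity

/-- The normalisation behind q_i: an edge survives with probability (1-q_i)^M ≈ e^{-1/k^9} =
p_{i+1}/p_i. -/
lemma qAt_mul (h : Regime n p) {i : ℕ} (hi : i ≤ numSteps n p) :
    qAt n p i * ((1 + eps n) * muAt n p 2 (kAt n p i) i) = 1 / (cliqueSize n p : ℝ) ^ 9 := by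
  have h1 := h.muAt_two_pos hi
  have h2 := h.eps_pos
  have h3 := h.three_le_cast
  unfold qAt
  field_simp

lemma qAt_mul_muAt_two_le (h : Regime n p) {i : ℕ} (hi : i ≤ numSteps n p) :
    qAt n p i * muAt n p 2 (kAt n p i) i ≤ 1 / (cliqueSize n p : ℝ) ^ 9 := by
  rw [← h.qAt_mul hi]
  refine mul_le_mul_of_nonneg_left ?_ (h.qAt_pos hi).le
  nlinarith [h.muAt_two_pos hi, h.eps_pos]

lemma qAt_mul_ninthRoot_le (h : Regime n p) {i : ℕ} (hi : i ≤ numSteps n p) :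
    qAt n p i * ninthRoot n ^ 8 ≤ 1 := by
  have h1 := mul_le_mul_of_nonneg_left (h.le_muAt_two hi) (h.qAt_pos hi).le
  have h2 := mul_le_mul_of_nonneg_left (h.qAt_mul_muAt_two_le hi)
    (show (0 : ℝ) ≤ 2 * cliqueSize n p by positivity)
  have h3 := h.three_le_cast
  have h4 : 2 * (cliqueSize n p : ℝ) * (1 / (cliqueSize n p : ℝ) ^ 9) ≤ 1 := by
    rw [mul_one_div, div_le_one (by positivity)]
    have : (cliqueSize n p : ℝ) ^ 2 ≤ (cliqueSize n p : ℝ) ^ 9 :=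
      pow_le_pow_right₀ (by linarith) (by norm_num)
    nlinarith
  linarith

lemma qAt_mul_muAt_three_le (h : Regime n p) {i : ℕ} (hi : i ≤ numSteps n p) :
    qAt n p i * (2 * (cliqueSize n p : ℝ) ^ 2 * muAt n p 3 (kAt n p i) i) * ninthRoot n ^ 8 ≤ 1 := by
  have h1 := mul_le_mul_of_nonneg_left (h.muAt_three_le hi)
    (mul_nonneg (h.qAt_pos hi).le (show (0 : ℝ) ≤ 2 * (cliqueSize n p : ℝ) ^ 2 by positivity))
  have h2 := mul_le_mul_of_nonneg_left (h.qAt_mul_muAt_two_le hi)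
    (show (0 : ℝ) ≤ 4 * (cliqueSize n p : ℝ) ^ 3 by positivity)
  have h3 := h.three_le_cast
  have h4 : 4 * (cliqueSize n p : ℝ) ^ 3 * (1 / (cliqueSize n p : ℝ) ^ 9) ≤ 1 := by
    rw [mul_one_div, div_le_one (by positivity)]
    have : (cliqueSize n p : ℝ) ^ 5 ≤ (cliqueSize n p : ℝ) ^ 9 :=
      pow_le_pow_right₀ (by linarith) (by norm_num)
    have h5 : (4 : ℝ) ≤ (cliqueSize n p : ℝ) ^ 2 := by nlinarith
    have : 4 * (cliqueSize n p : ℝ) ^ 3 ≤ (cliqueSize n p : ℝ) ^ 2 * (cliqueSize n p : ℝ) ^ 3 :=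
      mul_le_mul_of_nonneg_right h5 (by positivity)
    have e : (cliqueSize n p : ℝ) ^ 2 * (cliqueSize n p : ℝ) ^ 3 = (cliqueSize n p : ℝ) ^ 5 := by
      ring
    linarith
  linarith

lemma cliqueEvent (h : Regime n p) {i : ℕ} (hi : i ≤ numSteps n p) {G : SimpleGraph (Fin n)}
    (hG : NbrEvent p i G) : CliqueEvent p i G := by
  refine cliqueEvent_of_nbrEvent h.pos (h.kAt_le_n i) h.eps_pos.le h.eps_le_one ?_ hG
  have h1 := h.numSteps_add_one_le
  have h2 := h.kAt_le_cast i
  have hi' : (i : ℝ) + 1 ≤ 10 * (cliqueSize n p : ℝ) ^ 10 :=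
    le_trans (by exact_mod_cast (by omega : i + 1 ≤ numSteps n p + 1)) h1
  have h3 : 2 * ((kAt n p i : ℝ) * ((i : ℝ) + 1)) ≤ ninthRoot n := by
    have e := h.mul_pow_le_ninthRoot (c := 20) (m := 11) (by norm_num) (by norm_num)
    have := mul_le_mul h2 hi' (by positivity) (by positivity)
    refine le_trans (mul_le_mul_of_nonneg_left this zero_le_two) (le_trans (le_of_eq ?_) e)
    ring
  rw [eps_eq_inv]
  have hy := h.ninthRoot_pos
  calc _ = 2 * ((kAt n p i : ℝ) * ((i : ℝ) + 1)) * (ninthRoot n)⁻¹ ^ 2 := by ring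
    _ ≤ ninthRoot n * (ninthRoot n)⁻¹ ^ 2 := mul_le_mul_of_nonneg_right h3 (by positivity)
    _ = _ := by field_simp

end Regime

/-! ### One iteration -/

/-- Second-order Bonferroni: adding one set to a union of |S| sets loses at most |S|·b, and |S|² +
|S| ≤ (|S|+1)². If S has fewer than two elements nothing constrains b, hence the truncation at 0. -/
lemma card_biUnion_bounds {α β : Type} [DecidableEq β] (S : Finset α) (A : α → Finset β) (b : ℝ)
    (hb : ∀ v ∈ S, ∀ v' ∈ S, v ≠ v' → ((A v ∩ A v').card : ℝ) ≤ b) :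
    ((S.biUnion A).card : ℝ) ≤ ∑ v ∈ S, ((A v).card : ℝ) ∧
      ∑ v ∈ S, ((A v).card : ℝ) ≤ (S.biUnion A).card + (S.card : ℝ) ^ 2 * max b 0 := by
  constructor
  · exact_mod_cast Finset.card_biUnion_le
  induction S using Finset.induction_on with
  | empty => simp
  | insert a S ha ih =>
    have ih' := ih fun v hv v' hv' => hb v (Finset.mem_insert_of_mem hv) v'
      (Finset.mem_insert_of_mem hv')
    rw [Finset.sum_insert ha, Finset.biUnion_insert, Finset.card_insert_of_notMem ha]
    have h1 : ((A a ∪ S.biUnion A).card : ℝ) + ((A a ∩ S.biUnion A).card : ℝ) =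
        (A a).card + (S.biUnion A).card := by
      exact_mod_cast Finset.card_union_add_card_inter _ _
    have h2 : ((A a ∩ S.biUnion A).card : ℝ) ≤ S.card * max b 0 := by
      rw [Finset.inter_biUnion]
      calc (((S.biUnion fun v => A a ∩ A v)).card : ℝ) ≤ ∑ v ∈ S, ((A a ∩ A v).card : ℝ) := by
            exact_mod_cast Finset.card_biUnion_le
        _ ≤ ∑ _v ∈ S, max b 0 := Finset.sum_le_sum fun v hv =>
            (hb a (Finset.mem_insert_self _ _) v (Finset.mem_insert_of_mem hv)
              (by rintro rfl; exact ha hv)).trans (le_max_left _ _)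
        _ = _ := by rw [Finset.sum_const, nsmul_eq_mul]
    have h3 : 0 ≤ (S.card : ℝ) * max b 0 := by positivity
    have h4 : 0 ≤ max b 0 := le_max_right _ _
    push_cast
    nlinarith

/-- The cliques that destroy the common neighbour `w` of `S`. -/
def killers {n : ℕ} (G : SimpleGraph (Fin n)) (S : Finset (Fin n)) (j : ℕ) (w : Fin n) :
    Finset (Finset (Fin n)) :=
  (cliqueExt G ∅ j).filter fun K => w ∈ K ∧ ∃ v ∈ S, v ∈ K

/-- The edges between `w` and `S`. -/
def starEdges {n : ℕ} (S : Finset (Fin n)) (w : Fin n) : Finset (Sym2 (Fin n)) :=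
  S.image fun v => s(v, w)

lemma starEdges_injOn {n : ℕ} (S : Finset (Fin n)) (w : Fin n) :
    Set.InjOn (fun v => s(v, w)) (S : Set (Fin n)) := by
  intro v _ v' _ h
  exact Sym2.congr_left.1 h

lemma card_starEdges {n : ℕ} (S : Finset (Fin n)) (w : Fin n) :
    (starEdges S w).card = S.card :=
  Finset.card_image_of_injOn (starEdges_injOn S w)

lemma mk_mem_coveredEdges {n : ℕ} {Γ : Finset (Finset (Fin n))} {v w : Fin n} (h : v ≠ w) :
    s(v, w) ∈ coveredEdges Γ ↔ ∃ K ∈ Γ, v ∈ K ∧ w ∈ K := by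
  simp [coveredEdges, h]

/-- A sampled clique covers vw exactly when it contains both v and w, so losing w means hitting
`killers` or `starEdges`. This puts the count into the form handled by `survivors_tail_le`. -/
lemma commonNbrs_deleteEdges {n : ℕ} (G : SimpleGraph (Fin n)) (S : Finset (Fin n)) (j : ℕ)
    {Γ : Finset (Finset (Fin n))} (hΓ : Γ ⊆ cliqueExt G ∅ j) (T : Finset (Sym2 (Fin n))) :
    (commonNbrs (G.deleteEdges ↑(coveredEdges Γ ∪ T)) S : ℝ) =
      survivors (commonNbrSet G S) (killers G S j) (starEdges S) Γ T := by
  rw [survivors_eq_card, ← card_commonNbrSet]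
  congr 2
  ext w
  refine Iff.trans ?_ (@Finset.mem_filter _ _ (_) _ _).symm
  rw [mem_commonNbrSet, mem_commonNbrSet]
  simp only [SimpleGraph.deleteEdges_adj, Finset.mem_coe, Finset.mem_union, not_or]
  constructor
  · rintro ⟨hw, h⟩
    refine ⟨⟨hw, fun v hv => (h v hv).1⟩, Finset.disjoint_left.2 fun e he he' => ?_,
      Finset.disjoint_left.2 fun K hK hK' => ?_⟩
    · obtain ⟨v, hv, rfl⟩ := Finset.mem_image.1 he'
      exact (h v hv).2.2 he
    · obtain ⟨-, hwK, v, hv, hvK⟩ := Finset.mem_filter.1 hK'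
      exact (h v hv).2.1 ((mk_mem_coveredEdges (by grind)).2 ⟨K, hK, hvK, hwK⟩)
  · rintro ⟨⟨hw, h⟩, h2, h1⟩
    refine ⟨hw, fun v hv => ⟨h v hv, fun hc => ?_, fun hT => ?_⟩⟩
    · obtain ⟨K, hK, hvK, hwK⟩ := (mk_mem_coveredEdges (by grind)).1 hc
      exact Finset.disjoint_left.1 h1 hK (Finset.mem_filter.2 ⟨hΓ hK, hwK, v, hv, hvK⟩)
    · exact Finset.disjoint_left.1 h2 hT (Finset.mem_image_of_mem _ hv)

/-- Each vw with v ∈ S is already an edge, so the exemption of the pair {v, w} in `cliqueExt` is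
harmless. -/
lemma killers_eq_biUnion {n : ℕ} {G : SimpleGraph (Fin n)} {S : Finset (Fin n)} (j : ℕ)
    {w : Fin n} (hw : w ∈ commonNbrSet G S) :
    killers G S j w = S.biUnion fun v => cliqueExt G {v, w} j := by
  obtain ⟨hwS, hadj⟩ := mem_commonNbrSet.1 hw
  ext K
  simp only [killers, Finset.mem_filter, Finset.mem_biUnion, mem_cliqueExt, Finset.insert_subset_iff,
    Finset.singleton_subset_iff, Finset.mem_insert, Finset.mem_singleton]
  constructor
  · rintro ⟨⟨-, hc, h⟩, hwK, v, hv, hvK⟩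
    exact ⟨v, hv, ⟨hvK, hwK⟩, hc, fun x hx y hy hxy _ => h x hx y hy hxy (by simp)⟩
  · rintro ⟨v, hv, ⟨hvK, hwK⟩, hc, h⟩
    refine ⟨⟨Finset.empty_subset _, hc, fun x hx y hy hxy _ => ?_⟩, hwK, v, hv, hvK⟩
    by_cases hx' : (x = v ∨ x = w) ∧ (y = v ∨ y = w)
    · have := hadj v hv
      rcases hx' with ⟨rfl | rfl, rfl | rfl⟩
      · exact absurd rfl hxy
      · exact this
      · exact this.symm
      · exact absurd rfl hxy
    · exact h x hx y hy hxy hx'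

lemma cliqueExt_inter_subset {n : ℕ} (G : SimpleGraph (Fin n)) (j : ℕ) (v v' w : Fin n) :
    cliqueExt G {v, w} j ∩ cliqueExt G {v', w} j ⊆ cliqueExt G {v, v', w} j := by
  intro K hK
  rw [Finset.mem_inter, mem_cliqueExt, mem_cliqueExt] at hK
  obtain ⟨⟨h1, hc, h⟩, h2, -, -⟩ := hK
  rw [mem_cliqueExt]
  refine ⟨by grind, hc, fun x hx y hy hxy hn => h x hx y hy hxy (by grind)⟩

/-- Uses -q(1+2q) ≤ log(1-q) ≤ -q for q ≤ 1/2. Here x is the ideal exponent and D the shortfall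
caused by overlapping cliques. -/
lemma one_sub_rpow_bounds {q x D E : ℝ} (hq0 : 0 < q) (hq1 : q ≤ 1 / 2) (hx1 : x ≤ 1)
    (hE : 0 ≤ E) (hE1 : x - D ≤ q * E) (hE2 : q * E ≤ x) (hD0 : 0 ≤ D) (hD1 : D ≤ 1) :
    |(1 - q) ^ E - Real.exp (-x)| ≤ Real.exp (-x) * (2 * q + 2 * D) := by
  have h1q : 0 < 1 - q := by linarith
  rw [Real.rpow_def_of_pos h1q]
  have hl1 : Real.log (1 - q) ≤ -q := by linarith [Real.log_le_sub_one_of_pos h1q]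
  have hl2 : -q * (1 + 2 * q) ≤ Real.log (1 - q) := by
    refine le_trans ?_ (Real.one_sub_inv_le_log_of_pos h1q)
    have e : 1 - (1 - q)⁻¹ = -q / (1 - q) := by field_simp; ring
    rw [e, le_div_iff₀ h1q]
    nlinarith [mul_nonneg hq0.le (mul_nonneg hq0.le (show 0 ≤ 1 - 2 * q by linarith))]
  have hx := Real.exp_pos (-x)
  have hup : Real.log (1 - q) * E ≤ -x + D := by
    linarith [mul_le_mul_of_nonneg_right hl1 hE]
  have hlow : -x - 2 * q ≤ Real.log (1 - q) * E := by
    have h1 := mul_le_mul_of_nonneg_right hl2 hE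
    have h2 := mul_le_mul_of_nonneg_left (hE2.trans hx1) (show 0 ≤ 2 * q by linarith)
    linarith
  rw [abs_le]
  constructor
  · have h3 : Real.exp (-x) * (1 - 2 * q) ≤ Real.exp (Real.log (1 - q) * E) := by
      refine le_trans ?_ (Real.exp_le_exp.2 hlow)
      rw [sub_eq_add_neg (-x), Real.exp_add]
      exact mul_le_mul_of_nonneg_left (by linarith [Real.add_one_le_exp (-(2 * q))]) hx.le
    linarith [mul_nonneg hx.le hD0]
  · have h3 : Real.exp (Real.log (1 - q) * E) ≤ Real.exp (-x) * (1 + 2 * D) := by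
      refine (Real.exp_le_exp.2 hup).trans ?_
      rw [Real.exp_add]
      refine mul_le_mul_of_nonneg_left ?_ hx.le
      have := Real.abs_exp_sub_one_sub_id_le (x := D) (by rwa [abs_of_nonneg hD0])
      nlinarith [le_abs_self (Real.exp D - 1 - D)]
    linarith [mul_nonneg hx.le hq0.le]

/-! ### Survival probability of a common neighbour -/

namespace Regime

variable {n : ℕ} {p : ℝ}

lemma lambdaAt_succ (n : ℕ) (p : ℝ) (s i : ℕ) :
    lambdaAt n p s (i + 1) =
      lambdaAt n p s i * Real.exp (-(s / (cliqueSize n p : ℝ) ^ 9)) := by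
  rw [lambdaAt, lambdaAt, pAt_succ, mul_pow, ← Real.exp_nat_mul, mul_assoc]
  congr 3
  ring

lemma qAt_le_half (h : Regime n p) {i : ℕ} (hi : i ≤ numSteps n p) : qAt n p i ≤ 1 / 2 := by
  have h1 := h.qAt_mul_ninthRoot_le hi
  have h2 := h.qAt_pos hi
  have h3 : (2 : ℝ) ≤ ninthRoot n ^ 8 :=
    le_trans (by linarith [h.le_ninthRoot]) (le_self_pow₀ (by linarith [h.le_ninthRoot]) (by norm_num))
  nlinarith

lemma clamp_qAt (h : Regime n p) {i : ℕ} (hi : i ≤ numSteps n p) :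
    (clamp (qAt n p i) : ℝ) = qAt n p i :=
  toReal_clamp_of_mem (h.qAt_pos hi).le (by linarith [h.qAt_le_half hi])

variable {i : ℕ} {G : SimpleGraph (Fin n)}

lemma card_cliqueExt_pair_le (h : Regime n p) (hi : i ≤ numSteps n p) (hG : CliqueEvent p i G)
    {v w : Fin n} (hvw : v ≠ w) : ((cliqueExt G {v, w} (kAt n p i)).card : ℝ) ≤
      (1 + eps n) * muAt n p 2 (kAt n p i) i := by
  have h3 := h.three_le_kAt hi
  have hc : ({v, w} : Finset (Fin n)).card = 2 := Finset.card_pair hvw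
  have := hG {v, w} (kAt n p i) (by omega) le_rfl
  rw [hc, abs_le] at this
  linarith [this.2]

lemma card_cliqueExt_triple_le (h : Regime n p) (hi : i ≤ numSteps n p) (hG : CliqueEvent p i G)
    {v v' w : Fin n} (h1 : v ≠ v') (h2 : v ≠ w) (h3 : v' ≠ w) :
    ((cliqueExt G {v, v', w} (kAt n p i)).card : ℝ) ≤ 2 * muAt n p 3 (kAt n p i) i := by
  have hk := h.three_le_kAt hi
  have hc : ({v, v', w} : Finset (Fin n)).card = 3 := Finset.card_eq_three.2 ⟨v, v', w, h1, h2, h3, rfl⟩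
  have := hG {v, v', w} (kAt n p i) (by omega) le_rfl
  rw [hc, abs_le] at this
  have h5 := mul_le_mul_of_nonneg_right h.eps_le_one (muAt_nonneg (n := n) h.pos 3 (kAt n p i) i)
  linarith [this.2]

/-- Under ℛ_i the exponent is nonnegative, so neither the maximum nor the clamp acts. Multiplied by
the chance (1-q)^{|C_{vw}|} that no clique through vw is sampled, this gives (1-q)^M for every edge,
which is the purpose of ζ. -/
lemma one_sub_clamp_zetaAt (h : Regime n p) (hi : i ≤ numSteps n p) (hG : CliqueEvent p i G)
    {v w : Fin n} (hvw : v ≠ w) : 1 - (clamp (zetaAt p i G s(v, w)) : ℝ) =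
      (1 - qAt n p i) ^ ((1 + eps n) * muAt n p 2 (kAt n p i) i
        - ((cliqueExt G {v, w} (kAt n p i)).card : ℝ)) := by
  have h1 := h.card_cliqueExt_pair_le hi hG hvw
  have h2 := h.qAt_pos hi
  have h3 := h.qAt_le_half hi
  have e : s(v, w).toFinset = {v, w} := by ext x; simp
  rw [zetaAt, e, max_eq_left (sub_nonneg.2 h1), toReal_clamp_of_mem, sub_sub_cancel]
  · exact sub_nonneg.2 (Real.rpow_le_one (by linarith) (by linarith) (sub_nonneg.2 h1))
  · linarith [Real.rpow_nonneg (show 0 ≤ 1 - qAt n p i by linarith) ((1 + eps n)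
      * muAt n p 2 (kAt n p i) i - ((cliqueExt G {v, w} (kAt n p i)).card : ℝ))]

/-- The probability that a common neighbour survives one iteration. -/
lemma survival_prob (h : Regime n p) (hi : i ≤ numSteps n p) (hG : CliqueEvent p i G)
    {S : Finset (Fin n)} (hS : S.card ≤ cliqueSize n p) {w : Fin n} (hw : w ∈ commonNbrSet G S) :
    |(∏ _K ∈ killers G S (kAt n p i) w, (1 - (clamp (qAt n p i) : ℝ))) *
        (∏ e ∈ starEdges S w, (1 - (clamp (zetaAt p i G e) : ℝ)))
      - Real.exp (-(S.card / (cliqueSize n p : ℝ) ^ 9))| ≤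
      Real.exp (-(S.card / (cliqueSize n p : ℝ) ^ 9)) * (4 / ninthRoot n ^ 8) := by
  obtain ⟨hwS, hadj⟩ := mem_commonNbrSet.1 hw
  have hne : ∀ v ∈ S, v ≠ w := fun v hv => (hadj v hv).ne
  set q := qAt n p i with hq
  set M := (1 + eps n) * muAt n p 2 (kAt n p i) i with hM
  have hq0 : 0 < q := h.qAt_pos hi
  have hq1 : q ≤ 1 / 2 := h.qAt_le_half hi
  have h1q : 0 < 1 - q := by linarith
  have h3 := h.three_le_cast
  set k : ℝ := (cliqueSize n p : ℝ)
  set y := ninthRoot n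
  have hy : 0 < y := h.ninthRoot_pos
  set B := 2 * muAt n p 3 (kAt n p i) i with hB
  have hB0 : 0 ≤ B := mul_nonneg zero_le_two (muAt_nonneg h.pos _ _ _)
  rw [h.clamp_qAt hi, Finset.prod_const, starEdges, Finset.prod_image (starEdges_injOn S w),
    Finset.prod_congr rfl fun v hv => h.one_sub_clamp_zetaAt hi hG (hne v hv),
    ← Real.rpow_sum_of_pos h1q, ← Real.rpow_natCast, ← Real.rpow_add h1q]
  -- The combined exponent of 1-q is |killers| + ∑_v (M - |C_{vw}|). Inclusion-exclusion places it
  -- between sM - s²B and sM.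
  have hb := card_biUnion_bounds S (fun v => cliqueExt G {v, w} (kAt n p i)) B
    (fun v hv v' hv' hvv' => le_trans (by
      exact_mod_cast Finset.card_le_card (cliqueExt_inter_subset G _ v v' w))
      (h.card_cliqueExt_triple_le hi hG hvv' (hne v hv) (hne v' hv')))
  rw [← killers_eq_biUnion _ hw, max_eq_left hB0] at hb
  rw [Finset.sum_sub_distrib, Finset.sum_const, nsmul_eq_mul]
  have hC0 : ∑ v ∈ S, ((cliqueExt G {v, w} (kAt n p i)).card : ℝ) ≤ S.card * M := by
    rw [← nsmul_eq_mul]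
    exact Finset.sum_le_card_nsmul _ _ _ fun v hv => h.card_cliqueExt_pair_le hi hG (hne v hv)
  have hqM : q * M = 1 / k ^ 9 := h.qAt_mul hi
  have hSk : (S.card : ℝ) ≤ k := Nat.cast_le.2 hS
  have hk9 : k ^ 1 ≤ k ^ 9 := pow_le_pow_right₀ (by linarith) (by norm_num)
  have hqB : q * (k ^ 2 * B) * y ^ 8 ≤ 1 := by
    refine le_trans (le_of_eq ?_) (h.qAt_mul_muAt_three_le hi)
    rw [hB]; ring
  have hD0 : 0 ≤ q * (k ^ 2 * B) := by positivity
  have hDy : q * (k ^ 2 * B) ≤ 1 / y ^ 8 := by rwa [le_div_iff₀ (by positivity)]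
  have hqy : q ≤ 1 / y ^ 8 := by
    rw [le_div_iff₀ (by positivity)]
    exact h.qAt_mul_ninthRoot_le hi
  have hy1 : 1 / y ^ 8 ≤ 1 := by
    rw [div_le_one (by positivity)]
    exact one_le_pow₀ (by linarith [h.le_ninthRoot])
  have hS2 : (S.card : ℝ) ^ 2 * B ≤ k ^ 2 * B :=
    mul_le_mul_of_nonneg_right (pow_le_pow_left₀ (Nat.cast_nonneg _) hSk 2) hB0
  have hx : (S.card : ℝ) / k ^ 9 = q * (S.card * M) := by
    rw [mul_left_comm, hqM, mul_one_div]
  refine (one_sub_rpow_bounds hq0 hq1 ?_ ?_ (D := q * (k ^ 2 * B)) ?_ ?_ hD0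
    (hDy.trans hy1)).trans (mul_le_mul_of_nonneg_left ?_ (Real.exp_pos _).le)
  · rw [div_le_one (by positivity)]
    linarith
  · have : (0 : ℝ) ≤ (killers G S (kAt n p i) w).card := Nat.cast_nonneg _
    linarith
  · rw [hx, ← mul_sub]
    exact mul_le_mul_of_nonneg_left (by linarith [hb.2]) hq0.le
  · rw [hx]
    exact mul_le_mul_of_nonneg_left (by linarith [hb.1]) hq0.le
  · have e : 4 / y ^ 8 = 4 * (1 / y ^ 8) := by ring
    rw [e]
    linarith

end Regime

lemma card_filter_mem_starEdges_le {n : ℕ} (W S : Finset (Fin n)) (e : Sym2 (Fin n))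
    {_ : DecidablePred fun w => e ∈ starEdges S w} :
    (W.filter fun w => e ∈ starEdges S w).card ≤ 2 := by
  refine (Finset.card_le_card (t := e.toFinset) fun w hw => ?_).trans ?_
  · obtain ⟨v, -, rfl⟩ := Finset.mem_image.1 (Finset.mem_filter.1 hw).2
    simp
  · rw [Sym2.card_toFinset]
    split_ifs <;> omega

lemma card_filter_mem_killers_le {n : ℕ} (G : SimpleGraph (Fin n)) (W S : Finset (Fin n)) {j : ℕ}
    {K : Finset (Fin n)} (hK : K ∈ cliqueExt G ∅ j)
    {_ : DecidablePred fun w => K ∈ killers G S j w} :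
    (W.filter fun w => K ∈ killers G S j w).card ≤ j := by
  exact (Finset.card_le_card fun w hw => (Finset.mem_filter.1 (Finset.mem_filter.1 hw).2).2.1).trans
    (mem_cliqueExt.1 hK).2.1.le

lemma card_filter_card_lt_le {n : ℕ} (hn : 1 ≤ n) {K : ℕ} :
    ((Finset.univ.filter fun S : Finset (Fin n) => S.card + 1 ≤ K).card : ℝ) ≤ K * (n : ℝ) ^ K := by
  have h1 : (Finset.univ.filter fun S : Finset (Fin n) => S.card + 1 ≤ K) ⊆
      (Finset.range K).biUnion fun j => Finset.powersetCard j Finset.univ := by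
    intro S hS
    simp only [Finset.mem_filter, Finset.mem_univ, true_and] at hS
    simp only [Finset.mem_biUnion, Finset.mem_range, Finset.mem_powersetCard_univ, exists_eq_right']
    omega
  have h2 : (Finset.univ.filter fun S : Finset (Fin n) => S.card + 1 ≤ K).card ≤ K * n ^ K := by
    refine (Finset.card_le_card h1).trans (Finset.card_biUnion_le.trans ?_)
    refine (Finset.sum_le_card_nsmul _ _ (n ^ K) fun j hj => ?_).trans (by simp)
    rw [Finset.card_powersetCard, Finset.card_univ, Fintype.card_fin]
    exact (Nat.choose_le_pow n j).trans (Nat.pow_le_pow_right hn (Finset.mem_range.1 hj).le)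
  exact_mod_cast h2

/-! ### Tail bounds for one iteration and the union bound over `S` -/

namespace Regime

variable {n : ℕ} {p : ℝ}

/-- With θ = y^{-4}, the variance term is at most 2k²y, while θ times the deviation ε²λ/2 ≥ y^6/4 is
at least y²/4. The latter dominates since 16k² ≤ y. -/
lemma tail_exponent_le (h : Regime n p) {s i : ℕ} (hs : s + 1 ≤ kAt n p i) {V : ℝ}
    (hV : V ≤ 2 * (cliqueSize n p : ℝ) ^ 2 * n) :
    (ninthRoot n ^ 4)⁻¹ ^ 2 * V - (ninthRoot n ^ 4)⁻¹ * (eps n ^ 2 * lambdaAt n p s i / 2) ≤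
      -ninthRoot n := by
  have hy := h.ninthRoot_pos
  have hL := h.le_lambdaAt hs
  have hk := h.mul_pow_le_ninthRoot (c := 16) (m := 2) (by norm_num) (by norm_num)
  have hy1 := h.le_ninthRoot
  rw [← ninthRoot_pow n] at hV
  rw [eps_eq_inv]
  set y := ninthRoot n
  set k : ℝ := (cliqueSize n p : ℝ)
  have h1 : (y ^ 4)⁻¹ ^ 2 * V ≤ 2 * k ^ 2 * y := by
    refine (mul_le_mul_of_nonneg_left hV (by positivity)).trans (le_of_eq ?_)
    field_simp
  have h2 : y ^ 2 / 4 ≤ (y ^ 4)⁻¹ * (y⁻¹ ^ 2 * lambdaAt n p s i / 2) := by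
    have : (y ^ 4)⁻¹ * (y⁻¹ ^ 2 * lambdaAt n p s i / 2) =
        (y ^ 4)⁻¹ * y⁻¹ ^ 2 / 2 * lambdaAt n p s i := by ring
    rw [this]
    refine le_trans (le_of_eq ?_) (mul_le_mul_of_nonneg_left hL (by positivity))
    field_simp
    norm_num
  nlinarith

lemma inv_mul_cliqueSize_le (h : Regime n p) :
    (ninthRoot n ^ 4)⁻¹ * (cliqueSize n p : ℝ) ≤ 1 := by
  have h1 := h.mul_pow_le_ninthRoot (c := 1) (m := 1) (by norm_num) (by norm_num)
  have h2 : ninthRoot n ≤ ninthRoot n ^ 4 :=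
    le_self_pow₀ (by linarith [h.le_ninthRoot]) (by norm_num)
  have hy := h.ninthRoot_pos
  rw [inv_mul_le_one₀ (by positivity)]
  linarith

lemma card_le_cast (W : Finset (Fin n)) : (W.card : ℝ) ≤ n := by
  exact_mod_cast (Finset.card_le_univ W).trans (Fintype.card_fin n).le

/-- The inherited relative error (i+1)ε² is carried over unchanged. The survival probabilities add
at most 8/y^8 ≤ ε²/2, leaving another ε²/2 for the fluctuations. -/
lemma abs_mean_sub_lambdaAt_le (h : Regime n p) {i : ℕ} (hi : i < numSteps n p)
    {G : SimpleGraph (Fin n)} (hG : NbrEvent p i G) {S : Finset (Fin n)}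
    (hS : S.card + 1 ≤ kAt n p (i + 1)) :
    |∑ w ∈ commonNbrSet G S,
        (∏ _K ∈ killers G S (kAt n p i) w, (1 - (clamp (qAt n p i) : ℝ))) *
          ∏ e ∈ starEdges S w, (1 - (clamp (zetaAt p i G e) : ℝ))
      - lambdaAt n p S.card (i + 1)| ≤
      ((i : ℝ) + 1 + 1 / 2) * eps n ^ 2 * lambdaAt n p S.card (i + 1) := by
  have hR := h.cliqueEvent hi.le hG
  have hSk : S.card ≤ cliqueSize n p := by have := h.kAt_le (i + 1); omega
  have hSi : S.card + 1 ≤ kAt n p i := hS.trans (h.kAt_succ_le i)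
  have hy := h.ninthRoot_pos
  have hy1 := h.le_ninthRoot
  set W := commonNbrSet G S with hW
  set q := qAt n p i with hq
  set y := ninthRoot n with hyd
  set k : ℝ := (cliqueSize n p : ℝ) with hk
  have hN := hG S hSi
  rw [← card_commonNbrSet, ← hW] at hN
  set x := Real.exp (-(S.card / k ^ 9)) with hx
  have hx0 : 0 < x := Real.exp_pos _
  have hl : lambdaAt n p S.card (i + 1) = lambdaAt n p S.card i * x := lambdaAt_succ n p _ i
  set L := lambdaAt n p S.card i
  have hL : 0 ≤ L := lambdaAt_nonneg h.pos i (hSi.trans (h.kAt_le_n i) |>.trans' (by omega))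
  have h1 : |∑ w ∈ W, (∏ _K ∈ killers G S (kAt n p i) w, (1 - (clamp q : ℝ))) *
    ∏ e ∈ starEdges S w, (1 - (clamp (zetaAt p i G e) : ℝ)) - W.card * x| ≤
      W.card * (x * (4 / y ^ 8)) := by
    rw [← nsmul_eq_mul, ← nsmul_eq_mul, ← Finset.sum_const, ← Finset.sum_const,
      ← Finset.sum_sub_distrib]
    exact (Finset.abs_sum_le_sum_abs _ _).trans
      (Finset.sum_le_sum fun w hw => h.survival_prob hi.le hR hSk hw)
  have h2 : |(W.card : ℝ) * x - L * x| ≤ ((i : ℝ) + 1) * eps n ^ 2 * L * x := by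
    rw [← sub_mul, abs_mul, abs_of_pos hx0]
    exact mul_le_mul_of_nonneg_right hN hx0.le
  have hδ : ((i : ℝ) + 1) * eps n ^ 2 ≤ 1 := by
    have e1 := h.mul_pow_le_ninthRoot (c := 10) (m := 10) (by norm_num) (by norm_num)
    have e2 := h.numSteps_add_one_le
    have e3 : (i : ℝ) ≤ numSteps n p := Nat.cast_le.2 hi.le
    have e4 : eps n ^ 2 ≤ eps n := by nlinarith [h.eps_pos, h.eps_le_one]
    calc ((i : ℝ) + 1) * eps n ^ 2 ≤ y * eps n :=
          mul_le_mul (by linarith) e4 (by positivity) hy.le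
      _ = 1 := by rw [eps_eq_inv]; exact mul_inv_cancel₀ hy.ne'
  have hcard : (W.card : ℝ) ≤ 2 * L := by
    have := (abs_le.1 hN).2
    nlinarith [mul_le_mul_of_nonneg_right hδ hL]
  have h3 : (W.card : ℝ) * (x * (4 / y ^ 8)) ≤ 1 / 2 * eps n ^ 2 * (L * x) := by
    have e1 : 8 / y ^ 8 ≤ 1 / 2 * eps n ^ 2 := by
      rw [eps_eq_inv, div_le_iff₀ (by positivity)]
      have : 1 / 2 * (ninthRoot n)⁻¹ ^ 2 * y ^ 8 = y ^ 6 / 2 := by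
        rw [← hyd]; field_simp
      rw [this]
      have : y ≤ y ^ 6 := le_self_pow₀ (by linarith) (by norm_num)
      linarith
    calc _ ≤ 2 * L * (x * (4 / y ^ 8)) := mul_le_mul_of_nonneg_right hcard (by positivity)
      _ = 8 / y ^ 8 * (L * x) := by ring
      _ ≤ _ := mul_le_mul_of_nonneg_right e1 (by positivity)
  rw [hl]
  refine (abs_sub_le _ ((W.card : ℝ) * x) _).trans ?_
  linarith

/-- Supplies `V` in `tail_exponent_le`: each w has at most k star edges and at most s·q_i·M = s/k^9
≤ k sampled killers in expectation. -/
lemma sum_inclusion_probs_le (h : Regime n p) {i : ℕ} (hi : i ≤ numSteps n p)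
    {G : SimpleGraph (Fin n)} (hR : CliqueEvent p i G) {S : Finset (Fin n)}
    (hS : S.card ≤ cliqueSize n p) :
    (cliqueSize n p : ℝ) * ∑ w ∈ commonNbrSet G S,
        (∑ _K ∈ killers G S (kAt n p i) w, (clamp (qAt n p i) : ℝ)
          + ∑ e ∈ starEdges S w, (clamp (zetaAt p i G e) : ℝ)) ≤
      2 * (cliqueSize n p : ℝ) ^ 2 * n := by
  have hSkR : (S.card : ℝ) ≤ cliqueSize n p := Nat.cast_le.2 hS
  have hk3 := h.three_le_cast
  set W := commonNbrSet G S with hW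
  set q := qAt n p i with hq
  have hq0 : 0 < q := h.qAt_pos hi
  set k : ℝ := (cliqueSize n p : ℝ) with hk
  have h1 : ∀ w ∈ W, ∑ _K ∈ killers G S (kAt n p i) w, (clamp q : ℝ)
      + ∑ e ∈ starEdges S w, (clamp (zetaAt p i G e) : ℝ) ≤ 2 * k := by
    intro w hw
    have hne : ∀ v ∈ S, v ≠ w := fun v hv => ((mem_commonNbrSet.1 hw).2 v hv).ne
    have e1 : ∑ e ∈ starEdges S w, (clamp (zetaAt p i G e) : ℝ) ≤ k := by
      refine (Finset.sum_le_card_nsmul _ _ 1 fun e _ => clamp_le_one _).trans ?_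
      rw [card_starEdges, nsmul_eq_mul, mul_one]
      exact hSkR
    have e2 : ((killers G S (kAt n p i) w).card : ℝ) ≤
        S.card * ((1 + eps n) * muAt n p 2 (kAt n p i) i) := by
      rw [killers_eq_biUnion _ hw, ← nsmul_eq_mul]
      refine le_trans ?_ (Finset.sum_le_card_nsmul S
        (fun v => ((cliqueExt G {v, w} (kAt n p i)).card : ℝ)) _
        fun v hv => h.card_cliqueExt_pair_le hi hR (hne v hv))
      exact_mod_cast Finset.card_biUnion_le
    have e3 : ∑ _K ∈ killers G S (kAt n p i) w, (clamp q : ℝ) ≤ k := by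
      rw [Finset.sum_const, nsmul_eq_mul, h.clamp_qAt hi]
      calc _ ≤ S.card * ((1 + eps n) * muAt n p 2 (kAt n p i) i) * q :=
            mul_le_mul_of_nonneg_right e2 hq0.le
        _ = S.card * (q * ((1 + eps n) * muAt n p 2 (kAt n p i) i)) := by ring
        _ = S.card * (1 / k ^ 9) := by rw [h.qAt_mul hi]
        _ ≤ k * 1 := mul_le_mul hSkR
            (by rw [div_le_one (by positivity)]; exact one_le_pow₀ (by linarith))
            (by positivity) (by linarith)
        _ = k := mul_one k
    linarith
  have h2 := Finset.sum_le_card_nsmul W _ _ h1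
  rw [nsmul_eq_mul] at h2
  have h3 : (W.card : ℝ) * (2 * k) ≤ n * (2 * k) :=
    mul_le_mul_of_nonneg_right (card_le_cast W) (by linarith)
  calc _ ≤ k * (n * (2 * k)) := mul_le_mul_of_nonneg_left (h2.trans h3) (by linarith)
    _ = _ := by ring

/-- Concentration of a common-neighbour count in one iteration. -/
lemma commonNbrs_tail_le (h : Regime n p) {i : ℕ} (hi : i < numSteps n p) {G : SimpleGraph (Fin n)}
    (hG : NbrEvent p i G) {S : Finset (Fin n)} (hS : S.card + 1 ≤ kAt n p (i + 1)) :
    expect (cliqueExt G ∅ (kAt n p i)) (fun _ => (clamp (qAt n p i) : ℝ)) (fun Γ =>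
      expect G.edgeFinset (fun e => (clamp (zetaAt p i G e) : ℝ)) fun T =>
        if ((i + 1 : ℕ) + 1) * eps n ^ 2 * lambdaAt n p S.card (i + 1) <
            |(commonNbrs (G.deleteEdges ↑(coveredEdges Γ ∪ T)) S : ℝ)
              - lambdaAt n p S.card (i + 1)| then 1 else 0) ≤ 2 * Real.exp (-ninthRoot n) := by
  have hR := h.cliqueEvent hi.le hG
  have hSk : S.card ≤ cliqueSize n p := by have := h.kAt_le (i + 1); omega
  have hU : ∀ w ∈ commonNbrSet G S, killers G S (kAt n p i) w ⊆ cliqueExt G ∅ (kAt n p i) :=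
    fun w _ => Finset.filter_subset _ _
  have hF : ∀ w ∈ commonNbrSet G S, starEdges S w ⊆ G.edgeFinset := by
    intro w hw e he
    obtain ⟨v, hv, rfl⟩ := Finset.mem_image.1 he
    exact SimpleGraph.mem_edgeFinset.2 ((mem_commonNbrSet.1 hw).2 v hv)
  have hy := h.ninthRoot_pos
  have hk3 := h.three_le_cast
  have htail := survivors_tail_le (fun _ => NNReal.coe_nonneg (clamp (qAt n p i))) (fun _ => clamp_le_one (qAt n p i))
    (fun e => NNReal.coe_nonneg (clamp (zetaAt p i G e))) (fun e => clamp_le_one _) hU hF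
    -- A clique kills only w's among its own k_i ≤ k vertices, and an edge only its two endpoints.
    (M := cliqueSize n p) (θ := (ninthRoot n ^ 4)⁻¹)
    (fun K hK => le_trans (Nat.cast_le.2 (card_filter_mem_killers_le G _ S hK)) (h.kAt_le_cast i))
    (fun e _ => le_trans (Nat.cast_le.2 (card_filter_mem_starEdges_le _ S e))
      (by push_cast; linarith)) (by positivity) h.inv_mul_cliqueSize_le
    (eps n ^ 2 * lambdaAt n p S.card (i + 1) / 2)
  refine le_trans (expect_mono (fun _ => NNReal.coe_nonneg _) (fun _ => clamp_le_one _)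
    fun Γ hΓ => expect_mono (fun _ => NNReal.coe_nonneg _) (fun _ => clamp_le_one _)
    fun T _ => ?_) (htail.trans (mul_le_mul_of_nonneg_left
      (Real.exp_le_exp.2 (h.tail_exponent_le hS ?_)) zero_le_two))
  · rw [commonNbrs_deleteEdges G S (kAt n p i) hΓ T]
    set X := survivors (commonNbrSet G S) (killers G S (kAt n p i)) (starEdges S) Γ T with hX
    have hm := h.abs_mean_sub_lambdaAt_le hi hG hS
    set m := ∑ w ∈ commonNbrSet G S,
      (∏ _K ∈ killers G S (kAt n p i) w, (1 - (clamp (qAt n p i) : ℝ))) *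
        ∏ e ∈ starEdges S w, (1 - (clamp (zetaAt p i G e) : ℝ))
    by_cases hc : ((i + 1 : ℕ) + 1) * eps n ^ 2 * lambdaAt n p S.card (i + 1) <
        |X - lambdaAt n p S.card (i + 1)|
    · have := abs_sub_le X m (lambdaAt n p S.card (i + 1))
      rw [if_pos hc, if_pos]
      push_cast at hc
      linarith
    · rw [if_neg hc]
      split_ifs <;> simp
  · exact h.sum_inclusion_probs_le hi.le hR hSk

/-- The bound for the failure probability of the neighbourhood estimates in one iteration. -/
def failProb (n : ℕ) (p : ℝ) : ℝ :=
  (cliqueSize n p : ℝ) * (n : ℝ) ^ cliqueSize n p * (2 * Real.exp (-ninthRoot n))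

lemma indicator_not_nbrEvent_le (i : ℕ) {G : SimpleGraph (Fin n)} {P : Prop} {_ : Decidable P}
    (hP : P → ¬ NbrEvent p i G) : (if P then (1 : ℝ) else 0) ≤
      ∑ S ∈ Finset.univ.filter (fun S : Finset (Fin n) => S.card + 1 ≤ kAt n p i),
        if ((i : ℝ) + 1) * eps n ^ 2 * lambdaAt n p S.card i <
          |(commonNbrs G S : ℝ) - lambdaAt n p S.card i| then 1 else 0 := by
  have h0 : ∀ S ∈ Finset.univ.filter (fun S : Finset (Fin n) => S.card + 1 ≤ kAt n p i),
      (0 : ℝ) ≤ if ((i : ℝ) + 1) * eps n ^ 2 * lambdaAt n p S.card i <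
          |(commonNbrs G S : ℝ) - lambdaAt n p S.card i| then 1 else 0 := by
    intro S _
    split_ifs <;> simp
  split_ifs with hG
  · have hG' := hP hG
    simp only [NbrEvent, not_forall, not_le] at hG'
    obtain ⟨S, hS, hlt⟩ := hG'
    refine le_trans ?_ (Finset.single_le_sum h0 (Finset.mem_filter.2 ⟨Finset.mem_univ S, hS⟩))
    rw [if_pos hlt]
  · exact Finset.sum_nonneg h0

lemma sum_le_failProb (h : Regime n p) (i : ℕ) {f : Finset (Fin n) → ℝ}
    (hf : ∀ S : Finset (Fin n), S.card + 1 ≤ kAt n p i → f S ≤ 2 * Real.exp (-ninthRoot n)) :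
    ∑ S ∈ Finset.univ.filter (fun S : Finset (Fin n) => S.card + 1 ≤ kAt n p i), f S ≤
      failProb n p := by
  have hn1 : 1 ≤ n := by have := h.two_le; omega
  refine (Finset.sum_le_card_nsmul _ _ _ fun S hS => hf S (Finset.mem_filter.1 hS).2).trans ?_
  rw [nsmul_eq_mul]
  refine mul_le_mul_of_nonneg_right ((card_filter_card_lt_le hn1).trans ?_) (by positivity)
  exact mul_le_mul (h.kAt_le_cast i)
    (pow_le_pow_right₀ (by exact_mod_cast hn1) (h.kAt_le i)) (by positivity) (by positivity)

lemma step_not_nbrEvent_le (h : Regime n p) {i : ℕ} (hi : i < numSteps n p)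
    (sel : Finset (Finset (Fin n)) → Finset (Finset (Fin n))) {s : State n}
    (hs : NbrEvent p i s.graph) :
    (step p sel i s).toOuterMeasure {s' | ¬ NbrEvent p (i + 1) s'.graph} ≤
      ENNReal.ofReal (failProb n p) := by
  rw [toOuterMeasure_step]
  refine ENNReal.ofReal_le_ofReal ?_
  refine le_trans (expect_mono (fun _ => NNReal.coe_nonneg _) (fun _ => clamp_le_one _)
    fun Γ _ => expect_mono (fun _ => NNReal.coe_nonneg _) (fun _ => clamp_le_one _)
    fun T _ => indicator_not_nbrEvent_le (i + 1)
      (G := (nextState s Γ T (sel Γ)).graph) fun hP => hP) ?_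
  simp only [expect_sum]
  exact h.sum_le_failProb (i + 1) fun S hS => h.commonNbrs_tail_le hi hs hS

end Regime

/-! ### The initial binomial random graph -/

lemma randomSubset_apply_of_subset {α : Type} [Fintype α] {s T : Finset α} (r : α → ℝ)
    (hT : T ⊆ s) : randomSubset s r T =
      (((∏ a ∈ T, clamp (r a)) * ∏ a ∈ s \ T, (1 - clamp (r a)) : NNReal) : ENNReal) :=
  if_pos hT

lemma randomSubset_apply_of_not_subset {α : Type} [Fintype α] {s T : Finset α} (r : α → ℝ)
    (hT : ¬ T ⊆ s) : randomSubset s r T = 0 :=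
  if_neg hT

lemma randomSubset_const_apply {α : Type} [Fintype α] {s B T : Finset α} (x : ℝ) (hB : B ⊆ s)
    (hT : ∀ a, a ∈ T ↔ a ∈ s ∧ a ∉ B) : randomSubset s (fun _ => x) T =
      ((clamp x ^ (s.card - B.card) * (1 - clamp x) ^ B.card : NNReal) : ENNReal) := by
  obtain rfl : T = s \ B := by
    ext a
    rw [hT, Finset.mem_sdiff]
  rw [randomSubset_apply_of_subset _ Finset.sdiff_subset, Finset.sdiff_sdiff_eq_self hB,
    Finset.prod_const, Finset.prod_const, Finset.card_sdiff_of_subset hB]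

/-- The binomial random graph arises from the complete graph by deleting each edge independently
with probability `1 - p`. -/
lemma binomialRandom_toPMF (n : ℕ) (p : unitInterval) :
    (SimpleGraph.binomialRandom (Fin n) p).toPMF =
      (randomSubset (⊤ : SimpleGraph (Fin n)).edgeFinset fun _ => 1 - (p : ℝ)).map
        fun T : Finset (Sym2 (Fin n)) => (⊤ : SimpleGraph (Fin n)).deleteEdges ↑T := by
  have hp0 : 0 ≤ (p : ℝ) := p.2.1
  have hp1 : (p : ℝ) ≤ 1 := p.2.2
  have hc : clamp (1 - (p : ℝ)) = unitInterval.toNNReal (unitInterval.symm p) :=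
    NNReal.eq (toReal_clamp_of_mem (by linarith) (by linarith))
  have hc' : 1 - clamp (1 - (p : ℝ)) = unitInterval.toNNReal p := by
    refine NNReal.eq ?_
    rw [NNReal.coe_sub (show clamp (1 - (p : ℝ)) ≤ 1 from min_le_right _ _), NNReal.coe_one,
      toReal_clamp_of_mem (by linarith) (by linarith), sub_sub_cancel]
    rfl
  ext G
  have hGE : G.edgeFinset ⊆ (⊤ : SimpleGraph (Fin n)).edgeFinset :=
    SimpleGraph.edgeFinset_mono le_top
  -- Only one deletion set inside the complete edge set produces G, namely the non-edges of G.
  rw [MeasureTheory.Measure.toPMF_apply, SimpleGraph.binomialRandom_singleton, PMF.map_apply,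
    tsum_eq_single ((⊤ : SimpleGraph (Fin n)).edgeFinset \ G.edgeFinset)]
  · rw [if_pos, randomSubset_const_apply _ hGE fun _ => Finset.mem_sdiff]
    · have hncard : G.edgeSet.ncard = G.edgeFinset.card := Set.ncard_eq_toFinset_card' _
      rw [hc', hc, SimpleGraph.card_edgeFinset_top_eq_card_choose_two,
        hncard, Nat.card_eq_fintype_card, mul_comm]
      push_cast
      rfl
    · ext v w
      rw [SimpleGraph.deleteEdges_adj, SimpleGraph.top_adj, Finset.mem_coe, Finset.mem_sdiff,
        SimpleGraph.mem_edgeFinset, SimpleGraph.mem_edgeFinset, SimpleGraph.mem_edgeSet,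
        SimpleGraph.mem_edgeSet, SimpleGraph.top_adj]
      exact ⟨fun h => ⟨h.ne, fun hn => hn.2 h⟩, fun h => by_contra fun hn => h.2 ⟨h.1, hn⟩⟩
  · intro T hT
    split_ifs with hG
    · refine randomSubset_apply_of_not_subset _ fun hsub => hT ?_
      ext e
      have he : e ∈ G.edgeFinset ↔ e ∈ (⊤ : SimpleGraph (Fin n)).edgeFinset ∧ e ∉ T := by
        rw [SimpleGraph.mem_edgeFinset, SimpleGraph.mem_edgeFinset, hG,
          SimpleGraph.edgeSet_deleteEdges, Set.mem_sdiff, Finset.mem_coe]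
      rw [Finset.mem_sdiff, he]
      exact ⟨fun h => ⟨hsub h, fun h' => h'.2 h⟩, fun h => by_contra fun hn => h.2 ⟨h.1, hn⟩⟩
    · rfl

namespace Regime

variable {n : ℕ} {p : ℝ}

/-- G_{n,p} is treated as one deletion round from the complete graph without cliques, so the clique
index type is a dummy `Unit`. The mean is exactly λ_{s,0}, so there is no drift to absorb. -/
lemma commonNbrs_tail_zero_le (h : Regime n p) {S : Finset (Fin n)} (hS : S.card + 1 ≤ kAt n p 0) :
    expect (⊤ : SimpleGraph (Fin n)).edgeFinset (fun _ => (clamp (1 - p) : ℝ)) (fun T =>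
        if ((0 : ℕ) + 1) * eps n ^ 2 * lambdaAt n p S.card 0 <
            |(commonNbrs ((⊤ : SimpleGraph (Fin n)).deleteEdges ↑T) S : ℝ)
              - lambdaAt n p S.card 0| then 1 else 0) ≤ 2 * Real.exp (-ninthRoot n) := by
  have hSk : S.card ≤ cliqueSize n p := by have := h.kAt_le 0; omega
  have hSkR : (S.card : ℝ) ≤ cliqueSize n p := Nat.cast_le.2 hSk
  set G : SimpleGraph (Fin n) := ⊤
  set W := commonNbrSet G S with hW
  have hWS : W = Finset.univ \ S := by
    ext w
    rw [hW, mem_commonNbrSet]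
    simp only [G, SimpleGraph.top_adj, Finset.mem_sdiff, Finset.mem_univ, true_and]
    exact ⟨fun h => h.1, fun h => ⟨h, fun v hv hvw => h (hvw ▸ hv)⟩⟩
  have hcard : (W.card : ℝ) = n - S.card := by
    rw [hWS, Finset.card_sdiff_of_subset (Finset.subset_univ S), Finset.card_univ, Fintype.card_fin,
      Nat.cast_sub]
    exact (Finset.card_le_univ S).trans (Fintype.card_fin n).le
  have hF : ∀ w ∈ W, starEdges S w ⊆ G.edgeFinset := by
    intro w hw e he
    obtain ⟨v, hv, rfl⟩ := Finset.mem_image.1 he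
    exact SimpleGraph.mem_edgeFinset.2 ((mem_commonNbrSet.1 hw).2 v hv)
  have hy := h.ninthRoot_pos
  have hk3 := h.three_le_cast
  have hp0 := h.pos
  have hp1 := h.lt_one
  have htail := survivors_tail_le (α := Unit) (r := fun _ => 0) (s := ∅) (U := fun _ => ∅)
    (fun _ => le_rfl) (fun _ => zero_le_one)
    (fun _ => NNReal.coe_nonneg (clamp (1 - p))) (fun _ => clamp_le_one (1 - p))
    (fun _ _ => subset_rfl) hF (M := cliqueSize n p) (θ := (ninthRoot n ^ 4)⁻¹)
    (fun a ha => absurd ha (Finset.notMem_empty a))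
    (fun e _ => le_trans (Nat.cast_le.2 (card_filter_mem_starEdges_le _ S e))
      (by push_cast; linarith)) (by positivity) h.inv_mul_cliqueSize_le
    (eps n ^ 2 * lambdaAt n p S.card 0 / 2)
  rw [expect_empty] at htail
  have hm : ∑ w ∈ W, (∏ _a ∈ (∅ : Finset Unit), (1 - (0 : ℝ))) *
      ∏ _e ∈ starEdges S w, (1 - (clamp (1 - p) : ℝ)) = lambdaAt n p S.card 0 := by
    rw [toReal_clamp_of_mem (by linarith) (by linarith)]
    simp only [Finset.prod_const, card_starEdges, Finset.sum_const, Finset.card_empty, pow_zero,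
      one_mul, nsmul_eq_mul, hcard, lambdaAt, pAt_zero, sub_sub_cancel]
  rw [hm] at htail
  refine le_trans (expect_mono (fun _ => NNReal.coe_nonneg _) (fun _ => clamp_le_one _)
    fun T _ => ?_) (htail.trans (mul_le_mul_of_nonneg_left
      (Real.exp_le_exp.2 (h.tail_exponent_le hS ?_)) zero_le_two))
  · have hs : (commonNbrs (G.deleteEdges ↑T) S : ℝ) =
        survivors W (fun _ => (∅ : Finset Unit)) (starEdges S) ∅ T := by
      have := commonNbrs_deleteEdges G S 0 (Finset.empty_subset _) T
      rw [show coveredEdges (∅ : Finset (Finset (Fin n))) = ∅ by simp [coveredEdges],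
        Finset.empty_union] at this
      rw [this]
      simp [survivors, hW]
    rw [hs]
    have hL : 0 ≤ eps n ^ 2 * lambdaAt n p S.card 0 :=
      mul_nonneg (sq_nonneg _) (lambdaAt_nonneg h.pos 0 (by have := h.kAt_le_n 0; omega))
    set D := |survivors W (fun _ => (∅ : Finset Unit)) (starEdges S) ∅ T - lambdaAt n p S.card 0|
    by_cases hc : ((0 : ℕ) + 1) * eps n ^ 2 * lambdaAt n p S.card 0 < D
    · rw [if_pos hc, if_pos]
      push_cast at hc
      linarith
    · rw [if_neg hc]
      split_ifs <;> simp
  · have h1 : ∀ w ∈ W, ∑ _a ∈ (∅ : Finset Unit), (0 : ℝ)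
        + ∑ _e ∈ starEdges S w, (clamp (1 - p) : ℝ) ≤ cliqueSize n p := by
      intro w _
      rw [Finset.sum_empty, zero_add]
      refine (Finset.sum_le_card_nsmul _ _ 1 fun e _ => clamp_le_one _).trans ?_
      rw [card_starEdges, nsmul_eq_mul, mul_one]
      exact hSkR
    have h2 := Finset.sum_le_card_nsmul W _ _ h1
    rw [nsmul_eq_mul] at h2
    have h3 := mul_le_mul_of_nonneg_right (card_le_cast W) (Nat.cast_nonneg (cliqueSize n p))
    have h4 := mul_le_mul_of_nonneg_left (h2.trans h3) (Nat.cast_nonneg (cliqueSize n p))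
    have h5 : 0 ≤ (cliqueSize n p : ℝ) ^ 2 * n := by positivity
    linarith

end Regime

/-! ### Union bound over the iterations -/

/-- The trajectories along which some neighbourhood estimate fails at a time up to `m`. -/
def badTrajectories (n : ℕ) (p : ℝ) (m : ℕ) : Set (ℕ → State n) :=
  {h | ∃ i ≤ m, ¬ NbrEvent p i (h i).graph}

variable {n : ℕ} {p : unitInterval}

lemma run_zero_bad_le (h : Regime n p)
    (sel : Finset (Finset (Fin n)) → Finset (Finset (Fin n))) :
    (run p sel 0).toOuterMeasure (badTrajectories n p 0) ≤
      ENNReal.ofReal (Regime.failProb n p) := by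
  have e : run p sel 0 = (SimpleGraph.binomialRandom (Fin n) p).toPMF.map fun G _ => ⟨G, ∅⟩ := rfl
  rw [e, binomialRandom_toPMF, PMF.map_comp, toOuterMeasure_map_randomSubset]
  refine ENNReal.ofReal_le_ofReal ?_
  refine le_trans (expect_mono (fun _ => NNReal.coe_nonneg _) (fun _ => clamp_le_one _)
    fun T _ => Regime.indicator_not_nbrEvent_le (p := (p : ℝ)) 0
      (G := (⊤ : SimpleGraph (Fin n)).deleteEdges ↑T) fun hP => ?_) ?_
  · obtain ⟨i, hi, hb⟩ := hP
    obtain rfl : i = 0 := by omega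
    exact hb
  · rw [expect_sum]
    exact h.sum_le_failProb 0 fun S hS => h.commonNbrs_tail_zero_le hS

lemma run_bad_le (h : Regime n p) (sel : Finset (Finset (Fin n)) → Finset (Finset (Fin n)))
    {m : ℕ} (hm : m ≤ numSteps n p) :
    (run p sel m).toOuterMeasure (badTrajectories n p m) ≤
      ((m : ENNReal) + 1) * ENNReal.ofReal (Regime.failProb n p) := by
  induction m with
  | zero => simpa using run_zero_bad_le h sel
  | succ m ih =>
    have e : run p sel (m + 1) = (run p sel m).bind fun h =>
      (step (p : ℝ) sel m (h m)).map fun s j => if j ≤ m then h j else s := rfl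
    set δ := ENNReal.ofReal (Regime.failProb n p)
    rw [e, PMF.toOuterMeasure_bind_apply]
    -- Condition on the past: either it is already bad, or 𝒩_m holds and one further iteration fails
    -- with probability at most δ.
    have hstep : ∀ τ : ℕ → State n,
        ((step (p : ℝ) sel m (τ m)).map fun s j => if j ≤ m then τ j else s).toOuterMeasure
          (badTrajectories n p (m + 1)) ≤ (badTrajectories n p m).indicator 1 τ + δ := by
      intro τ
      by_cases hτ : τ ∈ badTrajectories n p m
      · rw [Set.indicator_of_mem hτ]
        refine le_trans ?_ le_self_add
        refine le_trans (MeasureTheory.measure_mono (Set.subset_univ _)) (le_of_eq ?_)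
        exact (PMF.toOuterMeasure_apply_eq_one_iff _ _).2 (Set.subset_univ _)
      · rw [Set.indicator_of_notMem hτ, zero_add, PMF.toOuterMeasure_map_apply]
        have hgood : ∀ i ≤ m, NbrEvent (p : ℝ) i (τ i).graph := by
          intro i hi
          by_contra hc
          exact hτ ⟨i, hi, hc⟩
        refine le_trans (MeasureTheory.measure_mono ?_)
          (h.step_not_nbrEvent_le (Nat.lt_of_succ_le hm) sel (hgood m le_rfl))
        rintro s ⟨i, hi, hb⟩
        by_cases him : i ≤ m
        · simp only [him, if_true] at hb
          exact absurd (hgood i him) hb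
        · obtain rfl : i = m + 1 := by omega
          simpa using hb
    calc _ ≤ ∑' τ, ((badTrajectories n p m).indicator (run p sel m) τ + run p sel m τ * δ) := by
          refine ENNReal.tsum_le_tsum fun τ => ?_
          refine (mul_le_mul_right (hstep τ) _).trans (le_of_eq ?_)
          rw [mul_add]
          congr 1
          by_cases hτ : τ ∈ badTrajectories n p m <;> simp [hτ]
      _ = (run p sel m).toOuterMeasure (badTrajectories n p m) + δ := by
          rw [ENNReal.tsum_add, ENNReal.tsum_mul_right, PMF.tsum_coe, one_mul,
            PMF.toOuterMeasure_apply]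
      _ ≤ ((m : ENNReal) + 1) * δ + δ := add_le_add_left (ih (by omega)) _
      _ = _ := by push_cast; ring

lemma le_run_good (h : Regime n p) (sel : Finset (Finset (Fin n)) → Finset (Finset (Fin n)))
    {η : ℝ} (hη : ((numSteps n p : ℝ) + 1) * Regime.failProb n p ≤ η) :
    ENNReal.ofReal (1 - η) ≤ (run p sel (numSteps n p)).toOuterMeasure
      {τ | ∀ i ≤ numSteps n p, NbrEvent (p : ℝ) i (τ i).graph} := by
  set P := run p sel (numSteps n p)
  have h1 : P.toOuterMeasure (badTrajectories n p (numSteps n p)) ≤ ENNReal.ofReal η := by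
    refine (run_bad_le h sel le_rfl).trans (le_trans (le_of_eq ?_) (ENNReal.ofReal_le_ofReal hη))
    rw [ENNReal.ofReal_mul (by positivity), ENNReal.ofReal_add (by positivity) zero_le_one,
      ENNReal.ofReal_natCast, ENNReal.ofReal_one]
  have h2 : (1 : ENNReal) ≤ P.toOuterMeasure {τ | ∀ i ≤ numSteps n p, NbrEvent (p : ℝ) i (τ i).graph}
      + P.toOuterMeasure (badTrajectories n p (numSteps n p)) := by
    rw [← (PMF.toOuterMeasure_apply_eq_one_iff P Set.univ).2 (Set.subset_univ _)]
    refine (MeasureTheory.measure_mono fun τ _ => ?_).trans (MeasureTheory.measure_union_le _ _)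
    by_cases hτ : ∀ i ≤ numSteps n p, NbrEvent (p : ℝ) i (τ i).graph
    · exact Or.inl hτ
    · push Not at hτ
      exact Or.inr hτ
  have h3 := h2.trans (add_le_add_right h1 _)
  have hη0 : 0 ≤ η := by
    refine le_trans ?_ hη
    unfold Regime.failProb
    positivity
  rw [ENNReal.ofReal_sub _ hη0, ENNReal.ofReal_one]
  exact tsub_le_iff_right.2 h3

/-! ### Large `n` -/

/-- The bound p ≤ 1-γ keeps log(1/p) away from 0, so k = O(log n) uniformly in p. -/
lemma cliqueSize_le_log {γ : ℝ} (hγ0 : 0 < γ) (hγ1 : γ < 1) {n : ℕ} (hlog : 1 ≤ Real.log n) {p : ℝ}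
    (hp0 : 0 < p) (hp : p ≤ 1 - γ) :
    (cliqueSize n p : ℝ) ≤ ((Real.log (1 / (1 - γ)))⁻¹ + 1) * Real.log n := by
  have hl : 0 < Real.log (1 / (1 - γ)) := Real.log_pos (by rw [lt_div_iff₀] <;> linarith)
  have hl2 : Real.log (1 / (1 - γ)) ≤ Real.log (1 / p) :=
    Real.log_le_log (one_div_pos.2 (by linarith)) (one_div_le_one_div_of_le hp0 hp)
  have h0 : 0 ≤ Real.logb (1 / p) n := div_nonneg (by linarith) (hl.le.trans hl2)
  have h1 : (cliqueSize n p : ℝ) < 1 / 9 * Real.logb (1 / p) n + 1 :=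
    Nat.ceil_lt_add_one (by positivity)
  have h2 : Real.logb (1 / p) n ≤ Real.log n / Real.log (1 / (1 - γ)) :=
    div_le_div_of_nonneg_left (by linarith) hl hl2
  rw [add_mul, inv_mul_eq_div]
  linarith

lemma eventually_regime {γ : ℝ} (hγ0 : 0 < γ) (hγ1 : γ < 1) (A : ℝ) :
    ∃ n₀ : ℕ, ∀ n : ℕ, n₀ ≤ n → ∀ p : ℝ, (n : ℝ) ^ (-(1 / 81) : ℝ) ≤ p → p ≤ 1 - γ →
      Regime n p ∧ ((cliqueSize n p : ℝ) + 1 + A) * Real.log n ≤ ninthRoot n := by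
  set C := (Real.log (1 / (1 - γ)))⁻¹ + 1 with hC
  have hl : 0 < Real.log (1 / (1 - γ)) := Real.log_pos (by rw [lt_div_iff₀] <;> linarith)
  have hC0 : 0 < C := by positivity
  have t1 : ∀ᶠ n : ℕ in Filter.atTop, Real.log n ^ (9 : ℝ) ≤ 1 / (3 * C ^ 9) * (n : ℝ) ^ (1 / 81 : ℝ) := by
    have := (tendsto_natCast_atTop_atTop (R := ℝ)).eventually
      ((isLittleO_log_rpow_rpow_atTop (9 : ℝ) (show (0 : ℝ) < 1 / 81 by norm_num)).def
        (show (0 : ℝ) < 1 / (3 * C ^ 9) by positivity))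
    filter_upwards [this] with n hn
    have h2 : 0 ≤ (n : ℝ) ^ (1 / 81 : ℝ) := by positivity
    simp only [Real.norm_eq_abs, abs_of_nonneg h2] at hn
    exact (le_abs_self _).trans hn
  have t2 : ∀ᶠ n : ℕ in Filter.atTop,
      Real.log n ^ (2 : ℝ) ≤ 1 / (C + 1 + |A|) * (n : ℝ) ^ (1 / 9 : ℝ) := by
    have := (tendsto_natCast_atTop_atTop (R := ℝ)).eventually
      ((isLittleO_log_rpow_rpow_atTop (2 : ℝ) (show (0 : ℝ) < 1 / 9 by norm_num)).def
        (show (0 : ℝ) < 1 / (C + 1 + |A|) by positivity))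
    filter_upwards [this] with n hn
    have h2 : 0 ≤ (n : ℝ) ^ (1 / 9 : ℝ) := by positivity
    simp only [Real.norm_eq_abs, abs_of_nonneg h2] at hn
    exact (le_abs_self _).trans hn
  have t3 : ∀ᶠ n : ℕ in Filter.atTop, 1 ≤ Real.log n :=
    (Real.tendsto_log_atTop.comp tendsto_natCast_atTop_atTop).eventually_ge_atTop 1
  obtain ⟨n₀, hn₀⟩ := Filter.eventually_atTop.1
    (t1.and (t2.and (t3.and (Filter.eventually_ge_atTop 2))))
  refine ⟨n₀, fun n hn p hp1 hp2 => ?_⟩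
  obtain ⟨h1, h2, h3, h4⟩ := hn₀ n hn
  have hn0 : (0 : ℝ) < n := by exact_mod_cast (by omega : 0 < n)
  have hp0 : 0 < p := (Real.rpow_pos_of_pos hn0 _).trans_le hp1
  have hk := cliqueSize_le_log hγ0 hγ1 h3 hp0 hp2
  rw [← hC] at hk
  rw [show (9 : ℝ) = ((9 : ℕ) : ℝ) by norm_num, Real.rpow_natCast] at h1
  rw [show (2 : ℝ) = ((2 : ℕ) : ℝ) by norm_num, Real.rpow_natCast] at h2
  refine ⟨⟨h4, by linarith, hp1, ?_⟩, ?_⟩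
  · have h5 := pow_le_pow_left₀ (Nat.cast_nonneg _) hk 9
    rw [mul_pow] at h5
    rw [one_div_mul_eq_div, le_div_iff₀ (by positivity)] at h1
    norm_num at h1 ⊢
    linarith
  · have hA := le_abs_self A
    rw [one_div_mul_eq_div, le_div_iff₀ (by positivity)] at h2
    have h6 : (cliqueSize n p : ℝ) + 1 + A ≤ (C + 1 + |A|) * Real.log n := by
      nlinarith [abs_nonneg A]
    have h7 := mul_le_mul_of_nonneg_right h6 (show 0 ≤ Real.log n by linarith)
    rw [ninthRoot]
    linarith

/-- The polynomial factors 2k(I+1) amount to at most n, so the total is at most n^{k+1}e^{-y}, and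
(k+1+A) log n ≤ y finishes. -/
lemma Regime.total_failProb_le {n : ℕ} {p : ℝ} (h : Regime n p) {A : ℝ}
    (hA : ((cliqueSize n p : ℝ) + 1 + A) * Real.log n ≤ ninthRoot n) :
    ((numSteps n p : ℝ) + 1) * Regime.failProb n p ≤ (n : ℝ) ^ (-A) := by
  have hn := h.cast_pos
  have h1 := h.numSteps_add_one_le
  have h2 := h.mul_pow_le_ninthRoot (c := 20) (m := 11) (by norm_num) (by norm_num)
  have h3 : ninthRoot n ≤ n := by
    rw [← ninthRoot_pow n]
    exact le_self_pow₀ (by linarith [h.le_ninthRoot]) (by norm_num)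
  have h4 : ((numSteps n p : ℝ) + 1) * cliqueSize n p * 2 ≤ n := by
    have := mul_le_mul_of_nonneg_right h1 (Nat.cast_nonneg (α := ℝ) (cliqueSize n p))
    linarith
  unfold Regime.failProb
  calc _ = ((numSteps n p : ℝ) + 1) * cliqueSize n p * 2 *
        ((n : ℝ) ^ cliqueSize n p * Real.exp (-ninthRoot n)) := by ring
    _ ≤ n * ((n : ℝ) ^ cliqueSize n p * Real.exp (-ninthRoot n)) :=
        mul_le_mul_of_nonneg_right h4 (by positivity)
    _ = Real.exp (((cliqueSize n p : ℝ) + 1) * Real.log n - ninthRoot n) := by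
        rw [sub_eq_add_neg, Real.exp_add, ← mul_assoc, ← pow_succ', add_mul, Real.exp_add, one_mul,
          Real.exp_log hn, Real.exp_nat_mul, Real.exp_log hn, pow_succ]
    _ ≤ Real.exp (Real.log n * -A) := Real.exp_le_exp.2 (by linarith)
    _ = _ := (Real.rpow_def_of_pos hn _).symm

end

end Nibble

theorem mainTheorem7 (γ : ℝ) (hγ0 : 0 < γ) (hγ1 : γ < 1) :
    -- with probability at least `1 - n^{-ω(1)}`, all `𝒩_i` and all `ℛ_i` hold
    (∀ A : ℝ, 0 < A → ∃ n₀ : ℕ, ∀ n : ℕ, n₀ ≤ n → ∀ p : unitInterval,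
      (n : ℝ) ^ (-(1 / 81) : ℝ) ≤ (p : ℝ) → (p : ℝ) ≤ 1 - γ →
      ∀ sel : Finset (Finset (Fin n)) → Finset (Finset (Fin n)),
        (∀ Γ, Nibble.IsMaxPacking Γ (sel Γ)) →
        ENNReal.ofReal (1 - (n : ℝ) ^ (-A)) ≤
            (Nibble.run p sel (Nibble.numSteps n p)).toOuterMeasure
              {h | ∀ i ≤ Nibble.numSteps n p, Nibble.NbrEvent (p : ℝ) i (h i).graph} ∧
        ENNReal.ofReal (1 - (n : ℝ) ^ (-A)) ≤
            (Nibble.run p sel (Nibble.numSteps n p)).toOuterMeasure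
              {h | ∀ i ≤ Nibble.numSteps n p, Nibble.CliqueEvent (p : ℝ) i (h i).graph}) ∧
    -- for all large `n`, the property `𝒩_i` implies the property `ℛ_i`
    (∃ n₀ : ℕ, ∀ n : ℕ, n₀ ≤ n → ∀ p : unitInterval,
      (n : ℝ) ^ (-(1 / 81) : ℝ) ≤ (p : ℝ) → (p : ℝ) ≤ 1 - γ →
      ∀ i ≤ Nibble.numSteps n p, ∀ G : SimpleGraph (Fin n),
        Nibble.NbrEvent (p : ℝ) i G → Nibble.CliqueEvent (p : ℝ) i G) := by
  refine ⟨fun A _ => ?_, ?_⟩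
  · obtain ⟨n₀, hn₀⟩ := Nibble.eventually_regime hγ0 hγ1 A
    refine ⟨n₀, fun n hn p hp1 hp2 sel _ => ?_⟩
    obtain ⟨h, hA⟩ := hn₀ n hn p hp1 hp2
    have hN := Nibble.le_run_good h sel (h.total_failProb_le hA)
    exact ⟨hN, hN.trans (MeasureTheory.measure_mono fun τ hτ i hi => h.cliqueEvent hi (hτ i hi))⟩
  · obtain ⟨n₀, hn₀⟩ := Nibble.eventually_regime hγ0 hγ1 0
    exact ⟨n₀, fun n hn p hp1 hp2 i hi G hG => (hn₀ n hn p hp1 hp2).1.cliqueEvent hi hG⟩
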